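/- Consider a two-armed bandit: for $k\in\{1,2\}$ the rewards of arm $k$ are i.i.d. with a distribution $\nu_k$ on $\mathbb R$ with mean $\mu_k$ that is $1$-subgaussian, i.e. $\mathbb E_{X\sim\nu_k}[e^{\lambda (X-\mu_k)}]\le e^{\lambda^2/2}$ for all $\lambda\in\mathbb R$, and the rewards of the two arms are independent. Let $\Delta=|\mu_1-\mu_2|$. For an algorithm that pulls arm $A_t$ and receives reward $r_t$ at time $t$, let $R_\mu(T)=T\max\{\mu_1,\mu_2\}-\mathbb E\big[\sum_{t=1}^T r_t\big]$; let $T_k(t)$ be the number of pulls of arm $k$ up to time $t$ and $\hat\mu_k(t)$ the average of the rewards of arm $k$ received up to time $t$. Write $\log^+x=\max\{0,\log x\}$ and $\log^a T=(\log T)^a$. The following algorithm (DETC) with inputs $T\in\mathbb N$ and $T_1=\log^{10}T$ is run; only its first $T$ pulls count. (Ties between the averages in the choice of $1'$, and in the final choice in the second case of Stage IV, are broken in favour of an arbitrary fixed arm.) Stage I. Pull arms $1,2$ once each, so $t=2$. While $|\hat\mu_1(t)-\hat\mu_2(t)|<\sqrt{\frac{16}{t}\log^+\frac{T_1}{t}}$,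 pull arms $1,2$ once each again. Stage II. Let $1'$ be the arm with the larger $\hat\mu_k(t)$ and $2'$ the other arm. While $T_{1'}(t)\le T_1$, pull arm $1'$. Then let $\mu'=\hat\mu_{1'}(t)$. Stage III. Pull arm $2'$ once and let $t_2=1$. Let $\theta_{n}$ be the average of the first $n$ rewards of arm $2'$ received in this stage. While $|\mu'-\theta_{t_2}|<\sqrt{\frac{2}{t_2}\log\big(\frac{eT}{t_2}(\log^2\frac{T}{t_2}+1)\big)}$ and $t_2<\log^2T$, pull arm $2'$ and increase $t_2$ by $1$. Stage IV. If $t_2<\log^2T$, pull from now on arm $1'$ if $\mu'\ge\theta_{t_2}$ and arm $2'$ otherwise. If $t_2\ge\log^2T$, pull arms $1,2$ once each and let $s=1$; let $p_{k,s}$ be the average of the first $s$ rewards of arm $k$ received in this stage. While $|p_{1,s}-p_{2,s}|<\sqrt{\frac{8}{s}\log^+\frac{T}{s}}$, pull arms $1,2$ once each and increase $s$ by $1$. Then pull forever the arm $k$ with the larger $p_{k,s}$. Theorem. In every such bandit the sum $\sum_{t=1}^T r_t$ is integrable for every $T$, so the regret is well defined, and: (i) if $\Delta>0$, then for this fixed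 bandit $\displaystyle\lim_{T\to\infty}\frac{R_\mu(T)}{\log T}=\frac{2}{\Delta}$; (ii) there is a universal constant $C$ such that, for all such bandits and all $T$ with $T\Delta^2\ge16e^3$, $$R_\mu(T)\le C\Big(\Delta+\frac{\log(T\Delta^2)}{\Delta}\Big)\qquad\text{and}\qquad R_\mu(T)\le C\big(\Delta+\sqrt T\big).$$ -/

import Mathlib

open MeasureTheory ProbabilityTheory Filter Topology

namespace DETC

/-- The reward table of a two-armed bandit: `x (k, i)` is the reward that arm `k` pays when it is
pulled for the `(i + 1)`-st time. The two arms are `0` and `1`. -/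
abbrev Rewards : Type := Fin 2 × ℕ → ℝ

/-- The average of the rewards that arm `k` pays on its pulls number `a + 1, …, a + n`. -/
noncomputable def avg (x : Rewards) (k : Fin 2) (a n : ℕ) : ℝ :=
  (∑ i ∈ Finset.range n, x (k, a + i)) / n

/-- The arm with the larger score, where arm `0` has score `u` and arm `1` has score `v`;
ties go to the arm `b`. -/
noncomputable def argmax (b : Fin 2) (u v : ℝ) : Fin 2 :=
  if v < u then 0 else if u < v then 1 else b

/-- The arm different from `k`. -/
def other (k : Fin 2) : Fin 2 := if k = 0 then 1 else 0

/-- The order in which the arms are pulled during uniform exploration: `0, 1, 0, 1, …`. -/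
def alternate (j : ℕ) : Fin 2 := if Even j then 0 else 1

/-! ### Stage I: explore both arms uniformly

After `s ≥ 1` pulls of each arm the time is `t = 2 * s`. The exploration goes on as long as
`|μ̂₁(t) - μ̂₂(t)| < √((16 / t) log⁺ (T₁ / t))`. -/

/-- The condition under which Stage I stops after `s` pulls of each arm. -/
def Stop₁ (T₁ : ℝ) (x : Rewards) (s : ℕ) : Prop :=
  1 ≤ s ∧ ¬ |avg x 0 0 s - avg x 1 0 s|
    < √(16 / (2 * s : ℝ) * Real.posLog (T₁ / (2 * s : ℝ)))

theorem exists_stop₁ (T₁ : ℝ) (x : Rewards) : ∃ s, Stop₁ T₁ x s := by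
  obtain ⟨n, hn⟩ := exists_nat_ge |T₁|
  refine ⟨n + 1, by omega, ?_⟩
  have h : Real.posLog (T₁ / (2 * ((n + 1 : ℕ) : ℝ))) = 0 := by
    rw [Real.posLog_eq_zero_iff, abs_div, div_le_one (by positivity),
      abs_of_pos (show (0 : ℝ) < 2 * ((n + 1 : ℕ) : ℝ) by positivity)]
    push_cast
    have : (0 : ℝ) ≤ n := Nat.cast_nonneg n
    linarith
  rw [h, mul_zero, Real.sqrt_zero, not_lt]
  exact abs_nonneg _

open Classical in
/-- The number of pulls of each arm in Stage I (the initial pull included). -/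
noncomputable def τ₁ (T₁ : ℝ) (x : Rewards) : ℕ := Nat.find (exists_stop₁ T₁ x)

/-! ### Stage II: commit to the arm with the larger average reward -/

/-- The arm `1'` chosen at the end of Stage I. -/
noncomputable def lead (T₁ : ℝ) (b : Fin 2) (x : Rewards) : Fin 2 :=
  argmax b (avg x 0 0 (τ₁ T₁ x)) (avg x 1 0 (τ₁ T₁ x))

/-- The arm `2'` that is not chosen. -/
noncomputable def rest (T₁ : ℝ) (b : Fin 2) (x : Rewards) : Fin 2 := other (lead T₁ b x)

/-- The total number of pulls of arm `1'` at the end of Stage II. Arm `1'` is pulled as long as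
its number of pulls is at most `T₁`, so this is the least `n ≥ τ₁` with `T₁ < n`. -/
noncomputable def pulls₂ (T₁ : ℝ) (x : Rewards) : ℕ := max (τ₁ T₁ x) (⌊T₁⌋₊ + 1)

/-- The average reward `μ'` of arm `1'` at the end of Stage II, over all its pulls so far. -/
noncomputable def leadMean (T₁ : ℝ) (b : Fin 2) (x : Rewards) : ℝ :=
  avg x (lead T₁ b x) 0 (pulls₂ T₁ x)

/-! ### Stage III: explore the arm that was not chosen, at most about `log² T` times -/

/-- The average `θ` of the first `n` rewards of arm `2'` in Stage III. -/
noncomputable def θ (T₁ : ℝ) (b : Fin 2) (x : Rewards) (n : ℕ) : ℝ :=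
  avg x (rest T₁ b x) (τ₁ T₁ x) n

/-- The condition under which Stage III stops after `n` pulls of arm `2'`. -/
def Stop₃ (T : ℕ) (T₁ : ℝ) (b : Fin 2) (x : Rewards) (n : ℕ) : Prop :=
  1 ≤ n ∧ ¬ (|leadMean T₁ b x - θ T₁ b x n|
      < √(2 / (n : ℝ) * Real.log (Real.exp 1 * T / n * (Real.log (T / n) ^ 2 + 1)))
    ∧ (n : ℝ) < Real.log T ^ 2)

theorem exists_stop₃ (T : ℕ) (T₁ : ℝ) (b : Fin 2) (x : Rewards) : ∃ n, Stop₃ T T₁ b x n := by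
  obtain ⟨n, hn⟩ := exists_nat_ge (Real.log T ^ 2)
  refine ⟨n + 1, by omega, fun h => ?_⟩
  have := h.2
  push_cast at this
  linarith

open Classical in
/-- The number `t₂` of pulls of arm `2'` in Stage III. -/
noncomputable def t₂ (T : ℕ) (T₁ : ℝ) (b : Fin 2) (x : Rewards) : ℕ :=
  Nat.find (exists_stop₃ T T₁ b x)

/-! ### Stage IV, first case (`t₂ < log² T`): commit -/

/-- The arm to which the algorithm commits if `t₂ < log² T`. -/
noncomputable def commit (T : ℕ) (T₁ : ℝ) (b : Fin 2) (x : Rewards) : Fin 2 :=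
  if θ T₁ b x (t₂ T T₁ b x) ≤ leadMean T₁ b x then lead T₁ b x else rest T₁ b x

/-! ### Stage IV, second case (`log² T ≤ t₂`): explore both arms again with fresh samples -/

/-- The number of pulls of arm `k` in Stages I, II and III together. -/
noncomputable def pulls₃ (T : ℕ) (T₁ : ℝ) (b : Fin 2) (x : Rewards) (k : Fin 2) : ℕ :=
  if k = lead T₁ b x then pulls₂ T₁ x else τ₁ T₁ x + t₂ T T₁ b x

/-- The average `p` of the first `s` rewards of arm `k` in the second uniform exploration. -/
noncomputable def p (T : ℕ) (T₁ : ℝ) (b : Fin 2) (x : Rewards) (k : Fin 2) (s : ℕ) : ℝ :=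
  avg x k (pulls₃ T T₁ b x k) s

/-- The condition under which the second uniform exploration stops after `s` pulls of each arm. -/
def Stop₄ (T : ℕ) (T₁ : ℝ) (b : Fin 2) (x : Rewards) (s : ℕ) : Prop :=
  1 ≤ s ∧ ¬ |p T T₁ b x 0 s - p T T₁ b x 1 s| < √(8 / (s : ℝ) * Real.posLog (T / s))

theorem exists_stop₄ (T : ℕ) (T₁ : ℝ) (b : Fin 2) (x : Rewards) : ∃ s, Stop₄ T T₁ b x s := by
  refine ⟨T + 1, by omega, ?_⟩
  have h : Real.posLog ((T : ℝ) / ((T + 1 : ℕ) : ℝ)) = 0 := by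
    rw [Real.posLog_eq_zero_iff, abs_of_nonneg (by positivity), div_le_one (by positivity)]
    push_cast
    linarith
  rw [h, mul_zero, Real.sqrt_zero, not_lt]
  exact abs_nonneg _

open Classical in
/-- The number of pulls of each arm in the second uniform exploration. -/
noncomputable def τ₃ (T : ℕ) (T₁ : ℝ) (b : Fin 2) (x : Rewards) : ℕ :=
  Nat.find (exists_stop₄ T T₁ b x)

/-- The arm to which the algorithm commits after the second uniform exploration. -/
noncomputable def commit' (T : ℕ) (T₁ : ℝ) (b : Fin 2) (x : Rewards) : Fin 2 :=
  argmax b (p T T₁ b x 0 (τ₃ T T₁ b x)) (p T T₁ b x 1 (τ₃ T T₁ b x))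

/-! ### The sequence of pulls and the regret -/

/-- The time at which Stage III ends. -/
noncomputable def time₃ (T : ℕ) (T₁ : ℝ) (b : Fin 2) (x : Rewards) : ℕ :=
  τ₁ T₁ x + pulls₂ T₁ x + t₂ T T₁ b x

/-- The arm `A_{t+1}` that the algorithm with inputs `T` and `T₁` pulls at time `t + 1`. -/
noncomputable def arm (T : ℕ) (T₁ : ℝ) (b : Fin 2) (x : Rewards) (t : ℕ) : Fin 2 :=
  if t < 2 * τ₁ T₁ x then alternate t
  else if t < τ₁ T₁ x + pulls₂ T₁ x then lead T₁ b x
  else if t < time₃ T T₁ b x then rest T₁ b x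
  else if (t₂ T T₁ b x : ℝ) < Real.log T ^ 2 then commit T T₁ b x
  else if t < time₃ T T₁ b x + 2 * τ₃ T T₁ b x then alternate (t - time₃ T T₁ b x)
  else commit' T T₁ b x

/-- The number of times that arm `k` has been pulled up to time `t`. -/
noncomputable def pulls (T : ℕ) (T₁ : ℝ) (b : Fin 2) (x : Rewards) (k : Fin 2) (t : ℕ) : ℕ :=
  ((Finset.range t).filter fun i => arm T T₁ b x i = k).card

/-- The reward `r_{t+1}` received at time `t + 1`. -/
noncomputable def reward (T : ℕ) (T₁ : ℝ) (b : Fin 2) (x : Rewards) (t : ℕ) : ℝ :=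
  x (arm T T₁ b x t, pulls T T₁ b x (arm T T₁ b x t) t)

/-- The sum of the rewards received at the times `1, …, T`. -/
noncomputable def totalReward (T : ℕ) (T₁ : ℝ) (b : Fin 2) (x : Rewards) : ℝ :=
  ∑ t ∈ Finset.range T, reward T T₁ b x t

/-- The law of the reward table: all rewards are independent, and those of arm `k` have
law `ν k`. -/
noncomputable def tableLaw (ν : Fin 2 → Measure ℝ) [∀ k, IsProbabilityMeasure (ν k)] :
    Measure Rewards :=
  Measure.infinitePi fun j : Fin 2 × ℕ => ν j.1

/-- The mean reward of arm `k`. -/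
noncomputable def mean (ν : Fin 2 → Measure ℝ) (k : Fin 2) : ℝ := ∫ y, y ∂(ν k)

/-- The gap between the mean rewards of the two arms. -/
noncomputable def gap (ν : Fin 2 → Measure ℝ) : ℝ := |mean ν 0 - mean ν 1|

/-- All arms have `1`-subgaussian rewards:
`𝔼 exp (λ X - λ 𝔼 X) ≤ exp (λ ^ 2 / 2)` for all real `λ`. -/
def IsSubgaussian (ν : Fin 2 → Measure ℝ) : Prop :=
  ∀ k, HasSubgaussianMGF (fun y => y - mean ν k) 1 (ν k)

/-- The expected cumulative regret up to the horizon `T` of the algorithm with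
inputs `T` and `T₁`. -/
noncomputable def regret (ν : Fin 2 → Measure ℝ) [∀ k, IsProbabilityMeasure (ν k)]
    (T : ℕ) (T₁ : ℝ) (b : Fin 2) : ℝ :=
  T * max (mean ν 0) (mean ν 1) - ∫ x, totalReward T T₁ b x ∂(tableLaw ν)

end DETC

/-!
The regret is the gap `Δ` times the expected number of pulls of the inferior arm (Wald's identity
`IsSubgaussian.integral_totalReward`, `IsSubgaussian.regret_eq`). It holds because the algorithm does
not look into the future: whether the `(i + 1)`-st pull of an arm takes place is decided without the
reward of that pull (`dependsOn_lt_pulls`).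

The pulls of the inferior arm are counted stage by stage (`pulls_le_add`).

* Uniform exploration. Peeling over dyadic blocks with Doob's maximal inequality shows that it ends
  with the wrong leader with probability at most `64 / (T₁ Δ²)`
  (`IsSubgaussian.measureReal_lead_le`), so that Stage II costs only `O(1 / Δ²)`; its expected length
  is `O(1 + (1 + log⁺ (T₁ Δ²)) / Δ²)` (`IsSubgaussian.integral_τ₁_le`). The second uniform exploration
  is the same procedure with parameter `2 T`, run on the rewards left over after Stage III. By the
  strong Markov property (`measure_inter_shift`) these are a fresh table, independent of whether
  the second exploration takes place at all.
* Stage III. The leader's average is known up to `1 / log² T`, and the threshold is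
  `√((2 + o(1)) log T / n)` uniformly in `1 ≤ n < log² T`; it falls below the gap at
  `n ≈ 2 log T / Δ²`, which is the length of the stage (`IsSubgaussian.integral_t₂_le_log` from above
  and `IsSubgaussian.le_integral_pulls` from below). The cap `log² T` is reached with
  probability `O(1 / log T)`, by Markov's inequality.
* The commitment after Stage III is wrong with probability `O(1 / T + 1 / (T Δ²))`
  (`IsSubgaussian.mul_measureReal_commit_le`). A plain union bound over `n < log² T` gives this, since
  the factor `log² (T / n) + 1` in the threshold pays for the number of terms and the drift
  `exp (- n Δ² / 4)` for their size.

Only Stage III contributes to the order `log T` for a fixed bandit, and it gives the limit `2 / Δ`. In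
the uniform bound the length of Stage III is at most `log² T + 1 ≤ 1 / Δ² + 1` if `Δ log T ≤ 1`, and
otherwise `log T ≤ 2 log (T Δ²)`.
-/

namespace DETC

/-! ### A maximal inequality for subgaussian random walks -/

section Maximal

variable {Ω : Type*} {mΩ : MeasurableSpace Ω} {P : Measure Ω}

theorem one_le_mgf_of_integral_eq_zero [IsProbabilityMeasure P] {X : Ω → ℝ} {c : NNReal}
    (hX : HasSubgaussianMGF X c P) (h0 : ∫ ω, X ω ∂P = 0) (l : ℝ) : 1 ≤ mgf X P l := by
  have h : ∫ ω, (l * X ω + 1) ∂P ≤ mgf X P l :=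
    integral_mono ((hX.integrable.const_mul l).add (integrable_const 1))
      (hX.integrable_exp_mul l) fun ω => Real.add_one_le_exp _
  rw [integral_add (hX.integrable.const_mul l) (integrable_const 1), integral_const_mul, h0] at h
  simpa using h

/-- The exponentials of a centred random walk form a submartingale, since the moment generating
function of a centred variable is at least `1`. -/
theorem submartingale_prod_exp {X : ℕ → Ω → ℝ} {c : NNReal}
    (hX : ∀ i, Measurable (X i)) (hi : iIndepFun X P) (hs : ∀ i, HasSubgaussianMGF (X i) c P)
    (h0 : ∀ i, ∫ ω, X i ω ∂P = 0) (l : ℝ) :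
    Submartingale (fun n ω => ∏ i ∈ Finset.range (n + 1), Real.exp (l * X i ω))
      (Filtration.natural (fun i ω => Real.exp (l * X i ω))
        fun i => (by fun_prop : Measurable fun ω => Real.exp (l * X i ω)).stronglyMeasurable) P := by
  have := hi.isProbabilityMeasure
  set Y : ℕ → Ω → ℝ := fun i ω => Real.exp (l * X i ω) with hY
  have hYm : ∀ i, StronglyMeasurable (Y i) := fun i =>
    (by fun_prop : Measurable fun ω => Real.exp (l * X i ω)).stronglyMeasurable
  have hYi : iIndepFun Y P := hi.comp (fun _ x => Real.exp (l * x)) fun _ => by fun_prop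
  have hint : ∀ n, Integrable (fun ω => ∏ i ∈ Finset.range (n + 1), Y i ω) P := fun n => by
    have h := (HasSubgaussianMGF.sum_of_iIndepFun hi (s := Finset.range (n + 1)) (c := fun _ => c)
      fun i _ => hs i).integrable_exp_mul l
    refine h.congr (ae_of_all _ fun ω => ?_)
    simp [hY, Finset.mul_sum, Real.exp_sum]
  have hadp : StronglyAdapted (Filtration.natural Y hYm)
      (fun n ω => ∏ i ∈ Finset.range (n + 1), Y i ω) := fun n => by
    refine Finset.stronglyMeasurable_fun_prod _ fun i hin => ?_
    exact (Filtration.stronglyAdapted_natural hYm i).mono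
      (Filtration.mono _ (Nat.lt_succ_iff.1 (Finset.mem_range.1 hin)))
  refine submartingale_nat hadp hint fun n => ?_
  have h1 : P[fun ω => ∏ i ∈ Finset.range (n + 1 + 1), Y i ω | Filtration.natural Y hYm n]
      =ᵐ[P] fun ω => (∏ i ∈ Finset.range (n + 1), Y i ω) * ∫ ω, Y (n + 1) ω ∂P := by
    have h2 : (fun ω => ∏ i ∈ Finset.range (n + 1 + 1), Y i ω)
        = (fun ω => ∏ i ∈ Finset.range (n + 1), Y i ω) * Y (n + 1) := by
      ext ω
      simp [Finset.prod_range_succ]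
    rw [h2]
    refine (condExp_mul_of_stronglyMeasurable_left (hadp n) (by rw [← h2]; exact hint (n + 1))
      ((hs (n + 1)).integrable_exp_mul l)).trans ?_
    filter_upwards [hYi.condExp_natural_ae_eq_of_lt hYm n.lt_succ_self] with ω hω
    exact congrArg _ hω
  filter_upwards [h1] with ω hω
  rw [hω]
  have h3 : 1 ≤ ∫ ω, Y (n + 1) ω ∂P :=
    one_le_mgf_of_integral_eq_zero (hs (n + 1)) (h0 (n + 1)) l
  exact le_mul_of_one_le_right (Finset.prod_nonneg fun i _ => (Real.exp_pos _).le) h3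

/-- Maximal form of the Chernoff bound: Doob's inequality for the exponential submartingale. -/
theorem measureReal_exists_sum_ge_le {X : ℕ → Ω → ℝ} {c : NNReal} (hc : 0 < c)
    (hX : ∀ i, Measurable (X i)) (hi : iIndepFun X P) (hs : ∀ i, HasSubgaussianMGF (X i) c P)
    (h0 : ∀ i, ∫ ω, X i ω ∂P = 0) {n : ℕ} {a : ℝ} (ha : 0 ≤ a) (hn : 1 ≤ n) :
    P.real {ω | ∃ s, 1 ≤ s ∧ s ≤ n ∧ a ≤ ∑ i ∈ Finset.range s, X i ω}
      ≤ Real.exp (-a ^ 2 / (2 * n * c)) := by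
  have := hi.isProbabilityMeasure
  obtain ⟨m, rfl⟩ : ∃ m, n = m + 1 := ⟨n - 1, by omega⟩
  have hc' : (0 : ℝ) < c := hc
  set l : ℝ := a / ((m + 1 : ℕ) * c) with hl
  have hl0 : 0 ≤ l := by positivity
  have hsub := submartingale_prod_exp hX hi hs h0 l
  have hnn : (0 : ℕ → Ω → ℝ) ≤ fun n ω => ∏ i ∈ Finset.range (n + 1), Real.exp (l * X i ω) :=
    fun n ω => Finset.prod_nonneg fun i _ => (Real.exp_pos _).le
  have hmax := maximal_ineq hsub hnn (ε := (⟨Real.exp (l * a), (Real.exp_pos _).le⟩ : NNReal)) m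
  set E := {ω | ((⟨Real.exp (l * a), (Real.exp_pos _).le⟩ : NNReal) : ℝ) ≤
    (Finset.range (m + 1)).sup' Finset.nonempty_range_add_one
      fun k => ∏ i ∈ Finset.range (k + 1), Real.exp (l * X i ω)} with hE
  have hprod : ∀ k ω, ∏ i ∈ Finset.range k, Real.exp (l * X i ω)
      = Real.exp (l * ∑ i ∈ Finset.range k, X i ω) := fun k ω => by
    rw [Finset.mul_sum, Real.exp_sum]
  have hint : Integrable (fun ω => Real.exp (l * ∑ i ∈ Finset.range (m + 1), X i ω)) P :=
    (HasSubgaussianMGF.sum_of_iIndepFun hi (s := Finset.range (m + 1)) (c := fun _ => c)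
      fun i _ => hs i).integrable_exp_mul l
  have hmgf : ∫ ω, Real.exp (l * ∑ i ∈ Finset.range (m + 1), X i ω) ∂P
      ≤ Real.exp ((m + 1 : ℕ) * c * l ^ 2 / 2) := by
    refine ((HasSubgaussianMGF.sum_of_iIndepFun hi (s := Finset.range (m + 1)) (c := fun _ => c)
      fun i _ => hs i).mgf_le l).trans_eq ?_
    simp
  have hEle : Real.exp (l * a) * P.real E ≤ Real.exp ((m + 1 : ℕ) * c * l ^ 2 / 2) := by
    have h1 := ENNReal.toReal_mono ENNReal.ofReal_ne_top hmax
    rw [ENNReal.toReal_mul, ENNReal.toReal_ofReal (integral_nonneg fun ω => hnn m ω)] at h1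
    refine le_trans h1 (le_trans ?_ hmgf)
    simp only [hprod]
    exact setIntegral_le_integral hint (ae_of_all _ fun ω => (Real.exp_pos _).le)
  have hsubset : {ω | ∃ s, 1 ≤ s ∧ s ≤ m + 1 ∧ a ≤ ∑ i ∈ Finset.range s, X i ω} ⊆ E := by
    rintro ω ⟨s, hs1, hs2, hs3⟩
    have h1 := Finset.le_sup' (fun k => ∏ i ∈ Finset.range (k + 1), Real.exp (l * X i ω))
      (Finset.mem_range.2 (show s - 1 < m + 1 by omega))
    refine le_trans ?_ h1
    simp only [hprod, Nat.sub_add_cancel hs1]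
    exact Real.exp_le_exp.2 (mul_le_mul_of_nonneg_left hs3 hl0)
  calc P.real _ ≤ P.real E := measureReal_mono hsubset
    _ ≤ Real.exp ((m + 1 : ℕ) * c * l ^ 2 / 2) / Real.exp (l * a) := by
      rw [le_div_iff₀ (Real.exp_pos _), mul_comm]; exact hEle
    _ = Real.exp (-a ^ 2 / (2 * (m + 1 : ℕ) * c)) := by
      rw [← Real.exp_sub, hl]
      congr 1
      have : ((m + 1 : ℕ) : ℝ) ≠ 0 := by positivity
      field_simp
      ring

end Maximal

/-! ### The reward table: independence and the strong Markov property -/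

instance (ν : Fin 2 → Measure ℝ) [∀ k, IsProbabilityMeasure (ν k)] :
    IsProbabilityMeasure (tableLaw ν) := by unfold tableLaw; infer_instance

theorem measurableSet_iSup_comap_of_dependsOn {E : Set Rewards} (hE : MeasurableSet E)
    {S : Set (Fin 2 × ℕ)} (h : DependsOn (fun x : Rewards => x ∈ E) S) :
    MeasurableSet[⨆ j ∈ S, MeasurableSpace.comap (fun x : Rewards => x j) inferInstance] E := by
  classical
  let r : Rewards → Rewards := fun x j => if j ∈ S then x j else 0
  have hr : @Measurable _ _
      (⨆ j ∈ S, MeasurableSpace.comap (fun x : Rewards => x j) inferInstance) _ r := by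
    refine @measurable_pi_lambda _ _ _ (_) _ _ fun j => ?_
    by_cases hj : j ∈ S
    · simp only [r, hj, if_true]
      refine (comap_measurable fun x : Rewards => x j).mono ?_ le_rfl
      exact le_iSup₂_of_le (f := fun (j : Fin 2 × ℕ) (_ : j ∈ S) =>
        MeasurableSpace.comap (fun x : Rewards => x j) inferInstance) j hj le_rfl
    · simp only [r, hj, if_false]
      exact @measurable_const _ _ _ (_) _
  have h1 : E = r ⁻¹' E := by
    ext x
    refine iff_of_eq (h ?_)
    intro j hj
    simp [r, hj]
  rw [h1]
  exact hr hE

theorem measure_inter_of_dependsOn (ν : Fin 2 → Measure ℝ) [∀ k, IsProbabilityMeasure (ν k)]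
    {E F : Set Rewards} (hE : MeasurableSet E) (hF : MeasurableSet F) {S T : Set (Fin 2 × ℕ)}
    (hST : Disjoint S T) (hES : DependsOn (fun x : Rewards => x ∈ E) S)
    (hFT : DependsOn (fun x : Rewards => x ∈ F) T) :
    tableLaw ν (E ∩ F) = tableLaw ν E * tableLaw ν F := by
  have h1 : iIndepFun (fun (j : Fin 2 × ℕ) (x : Rewards) => x j) (tableLaw ν) :=
    iIndepFun_infinitePi (X := fun _ x => x) fun _ => measurable_id
  have h2 := indep_iSup_of_disjoint
    (fun j : Fin 2 × ℕ => (measurable_pi_apply j : Measurable fun x : Rewards => x j).comap_le)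
    h1 hST
  rw [Indep_iff] at h2
  exact h2 E F (measurableSet_iSup_comap_of_dependsOn hE hES)
    (measurableSet_iSup_comap_of_dependsOn hF hFT)

/-- The table of the rewards that are left after arm `k` has been pulled `n k` times. -/
def shift (n : Fin 2 → ℕ) (x : Rewards) : Rewards := fun j => x (j.1, n j.1 + j.2)

@[fun_prop]
theorem measurable_shift (n : Fin 2 → ℕ) : Measurable (shift n) := by
  unfold shift; fun_prop

theorem map_shift (ν : Fin 2 → Measure ℝ) [∀ k, IsProbabilityMeasure (ν k)] (n : Fin 2 → ℕ) :
    (tableLaw ν).map (shift n) = tableLaw ν := by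
  have h1 : iIndepFun (fun (j : Fin 2 × ℕ) (x : Rewards) => x j) (tableLaw ν) :=
    iIndepFun_infinitePi (X := fun _ x => x) fun _ => measurable_id
  have hinj : Function.Injective fun j : Fin 2 × ℕ => ((j.1, n j.1 + j.2) : Fin 2 × ℕ) := by
    rintro ⟨k, i⟩ ⟨k', i'⟩ h
    simp only [Prod.mk.injEq] at h
    obtain ⟨rfl, h⟩ := h
    simpa using h
  have h2 := (h1.precomp hinj).map_fun_eq_infinitePi_map fun j => by fun_prop
  have h3 : ∀ j : Fin 2 × ℕ, (tableLaw ν).map (fun x : Rewards => x (j.1, n j.1 + j.2)) = ν j.1 :=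
    fun j => Measure.infinitePi_map_eval (fun j : Fin 2 × ℕ => ν j.1) (j.1, n j.1 + j.2)
  change (tableLaw ν).map (fun x (j : Fin 2 × ℕ) => x (j.1, n j.1 + j.2)) = _
  refine h2.trans ?_
  unfold tableLaw
  congr 1
  ext1 j
  exact h3 j

/-- Two tables agree on the first `n k` rewards of each arm `k`. -/
def Agree (n : Fin 2 → ℕ) (x y : Rewards) : Prop := ∀ k i, i < n k → x (k, i) = y (k, i)

/-- `N k` pulls of each arm `k`, where `N` is a stopping rule: whether `N = n` is decided by the
first `n k` rewards of each arm `k`. -/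
structure IsStoppingRule (N : Rewards → Fin 2 → ℕ) : Prop where
  measurable : Measurable N
  eq_of_agree : ∀ x y, Agree (N x) x y → N y = N x

/-- Strong Markov property: the rewards left over by a stopping rule `N` are distributed as a new
table, independently of all events `A` that are decided by the rewards before `N`. -/
theorem measure_inter_shift (ν : Fin 2 → Measure ℝ) [∀ k, IsProbabilityMeasure (ν k)]
    {N : Rewards → Fin 2 → ℕ} (hN : IsStoppingRule N) {A B : Set Rewards} (hA : MeasurableSet A)
    (hAN : ∀ x y, Agree (N x) x y → x ∈ A → y ∈ A) (hB : MeasurableSet B) :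
    tableLaw ν (A ∩ {x | shift (N x) x ∈ B}) = tableLaw ν A * tableLaw ν B := by
  have hmeas : ∀ n, MeasurableSet (A ∩ N ⁻¹' {n}) := fun n =>
    hA.inter (hN.measurable (measurableSet_singleton n))
  have hshift : ∀ n, MeasurableSet (shift n ⁻¹' B) := fun n => measurable_shift n hB
  have hagree : ∀ n x y, Agree n x y → x ∈ A ∩ N ⁻¹' {n} → y ∈ A ∩ N ⁻¹' {n} := by
    rintro n x y hxy ⟨hx, rfl⟩
    exact ⟨hAN x y hxy hx, hN.eq_of_agree x y hxy⟩
  have hsplit : ∀ n, tableLaw ν ((A ∩ N ⁻¹' {n}) ∩ shift n ⁻¹' B)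
      = tableLaw ν (A ∩ N ⁻¹' {n}) * tableLaw ν B := by
    intro n
    rw [measure_inter_of_dependsOn ν (hmeas n) (hshift n) (S := {j | j.2 < n j.1})
      (T := {j | n j.1 ≤ j.2}), ← Measure.map_apply (measurable_shift n) hB, map_shift]
    · rw [Set.disjoint_left]
      intro j h1 h2
      exact (not_lt.2 (show n j.1 ≤ j.2 from h2)) h1
    · intro x y hxy
      exact propext ⟨hagree n x y fun k i hi => hxy (k, i) hi,
        hagree n y x fun k i hi => (hxy (k, i) hi).symm⟩
    · intro x y hxy
      have : shift n x = shift n y := by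
        funext j
        exact hxy (j.1, n j.1 + j.2) (Nat.le_add_right _ _)
      simp [this]
  have h1 : A ∩ {x | shift (N x) x ∈ B} = ⋃ n, (A ∩ N ⁻¹' {n}) ∩ shift n ⁻¹' B := by
    ext x
    simp only [Set.mem_inter_iff, Set.mem_ofPred_eq, Set.mem_iUnion, Set.mem_preimage,
      Set.mem_singleton_iff]
    constructor
    · rintro ⟨h, h'⟩
      exact ⟨N x, ⟨h, rfl⟩, h'⟩
    · rintro ⟨n, ⟨h, rfl⟩, h'⟩
      exact ⟨h, h'⟩
  have h2 : A = ⋃ n, A ∩ N ⁻¹' {n} := by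
    ext x
    simp
  have hdisj : Pairwise (Function.onFun Disjoint fun n => A ∩ N ⁻¹' {n}) := by
    intro m n hmn
    rw [Function.onFun, Set.disjoint_left]
    rintro x ⟨-, rfl⟩ ⟨-, h⟩
    exact hmn h
  rw [h1, measure_iUnion (fun m n hmn => (hdisj hmn).mono Set.inter_subset_left
    Set.inter_subset_left) fun n => (hmeas n).inter (hshift n)]
  conv_rhs => rw [h2, measure_iUnion hdisj hmeas]
  simp_rw [hsplit, ENNReal.tsum_mul_right]

theorem measurable_shift_stoppingRule {N : Rewards → Fin 2 → ℕ} (hN : Measurable N) :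
    Measurable fun x => shift (N x) x :=
  (measurable_from_prod_countable_left (f := fun p : Rewards × (Fin 2 → ℕ) => shift p.2 p.1)
    fun n => measurable_shift n).comp (measurable_id.prodMk hN)

theorem measureReal_shift (ν : Fin 2 → Measure ℝ) [∀ k, IsProbabilityMeasure (ν k)]
    {N : Rewards → Fin 2 → ℕ} (hN : IsStoppingRule N) {B : Set Rewards} (hB : MeasurableSet B) :
    (tableLaw ν).real {x | shift (N x) x ∈ B} = (tableLaw ν).real B := by
  have := measure_inter_shift ν hN MeasurableSet.univ (fun _ _ _ h => h) hB
  rw [Set.univ_inter, measure_univ, one_mul] at this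
  exact congrArg ENNReal.toReal this

theorem integral_indicator_shift (ν : Fin 2 → Measure ℝ) [∀ k, IsProbabilityMeasure (ν k)]
    {N : Rewards → Fin 2 → ℕ} (hN : IsStoppingRule N) {A : Set Rewards} (hA : MeasurableSet A)
    (hAN : ∀ x y, Agree (N x) x y → x ∈ A → y ∈ A) {f : Rewards → ℝ} (hf : Measurable f) :
    ∫ x, A.indicator (fun x => f (shift (N x) x)) x ∂(tableLaw ν)
      = (tableLaw ν).real A * ∫ x, f x ∂(tableLaw ν) := by
  have hφ := measurable_shift_stoppingRule hN.measurable
  have h1 : ((tableLaw ν).restrict A).map (fun x => shift (N x) x)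
      = tableLaw ν A • tableLaw ν := by
    ext B hB
    rw [Measure.map_apply hφ hB, Measure.restrict_apply (hφ hB), Set.inter_comm]
    exact measure_inter_shift ν hN hA hAN hB
  rw [integral_indicator hA, ← integral_map (φ := fun x => shift (N x) x) hφ.aemeasurable
    hf.aestronglyMeasurable, h1, integral_smul_measure, smul_eq_mul]
  rfl

/-- An event that does not depend on the `(i + 1)`-st reward of arm `k` is independent of it. -/
theorem integral_mul_indicator_of_dependsOn (ν : Fin 2 → Measure ℝ)
    [∀ k, IsProbabilityMeasure (ν k)] {E : Set Rewards} (hE : MeasurableSet E) (j : Fin 2 × ℕ)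
    (h : DependsOn (fun x : Rewards => x ∈ E) {j}ᶜ) :
    ∫ x, E.indicator (fun x => x j) x ∂(tableLaw ν)
      = mean ν j.1 * (tableLaw ν).real E := by
  have h1 : ((tableLaw ν).restrict E).map (fun x => x j) = tableLaw ν E • ν j.1 := by
    ext B hB
    have hB' : MeasurableSet ((fun x : Rewards => x j) ⁻¹' B) := measurable_pi_apply j hB
    rw [Measure.map_apply (measurable_pi_apply j) hB, Measure.restrict_apply hB',
      Set.inter_comm, measure_inter_of_dependsOn ν hE hB' (S := {j}ᶜ) (T := {j})
        disjoint_compl_left h]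
    · have h2 := Measure.infinitePi_map_eval (fun j : Fin 2 × ℕ => ν j.1) j
      have h3 : tableLaw ν ((fun x : Rewards => x j) ⁻¹' B) = ν j.1 B := by
        conv_rhs => rw [← h2, Measure.map_apply (measurable_pi_apply j) hB]
        rfl
      rw [h3]
      rfl
    · intro x y hxy
      simp [hxy j rfl]
  rw [integral_indicator hE, ← integral_map (φ := fun x : Rewards => x j)
    (f := fun y => y) (measurable_pi_apply j).aemeasurable
    measurable_id.aestronglyMeasurable, h1, integral_smul_measure, smul_eq_mul, mul_comm]
  rfl

/-! ### Subgaussian tails of the averages -/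

section Tails

theorem hasSubgaussianMGF_mul_of_sq_eq_one {Ω : Type*} {mΩ : MeasurableSpace Ω} {P : Measure Ω}
    {X : Ω → ℝ} {c : NNReal} (h : HasSubgaussianMGF X c P) {r : ℝ} (hr : r ^ 2 = 1) :
    HasSubgaussianMGF (fun ω => r * X ω) c P := by
  rcases (by simpa using hr : r = 1 ∨ r = -1) with rfl | rfl
  · simpa using h
  · simp only [neg_one_mul]; exact h.neg

variable {ν : Fin 2 → Measure ℝ} [∀ k, IsProbabilityMeasure (ν k)]

theorem identDistrib_eval (j : Fin 2 × ℕ) :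
    IdentDistrib id (fun x : Rewards => x j) (ν j.1) (tableLaw ν) where
  aemeasurable_fst := aemeasurable_id
  aemeasurable_snd := (measurable_pi_apply j).aemeasurable
  map_eq := by
    rw [Measure.map_id]
    exact (Measure.infinitePi_map_eval (fun j : Fin 2 × ℕ => ν j.1) j).symm

theorem IsSubgaussian.hasSubgaussianMGF (h : IsSubgaussian ν) (j : Fin 2 × ℕ) :
    HasSubgaussianMGF (fun x : Rewards => x j - mean ν j.1) 1 (tableLaw ν) :=
  (h j.1).congr_identDistrib
    ((identDistrib_eval j).comp (measurable_id.sub_const (mean ν j.1)))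

theorem IsSubgaussian.integrable_id (h : IsSubgaussian ν) (k : Fin 2) :
    Integrable (fun y => y) (ν k) := by
  have := (h k).integrable.add (integrable_const (mean ν k))
  refine this.congr (ae_of_all _ fun y => ?_)
  simp

theorem IsSubgaussian.integrable_eval (h : IsSubgaussian ν) (j : Fin 2 × ℕ) :
    Integrable (fun x : Rewards => x j) (tableLaw ν) :=
  (identDistrib_eval j).integrable_iff.1 (h.integrable_id j.1)

theorem IsSubgaussian.integral_sub_mean (h : IsSubgaussian ν) (j : Fin 2 × ℕ) :
    ∫ x : Rewards, (x j - mean ν j.1) ∂(tableLaw ν) = 0 := by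
  rw [integral_sub (h.integrable_eval j) (integrable_const _),
    ← (identDistrib_eval j).integral_eq]
  simp [mean]

theorem iIndepFun_sub_mean :
    iIndepFun (fun (j : Fin 2 × ℕ) (x : Rewards) => x j - mean ν j.1) (tableLaw ν) :=
  iIndepFun_infinitePi (X := fun (j : Fin 2 × ℕ) y => y - mean ν j.1) fun _ => by fun_prop

theorem avg_sub_mean (x : Rewards) (k : Fin 2) (a : ℕ) {n : ℕ} (hn : 1 ≤ n) (m : ℝ) :
    avg x k a n - m = (∑ i ∈ Finset.range n, (x (k, a + i) - m)) / n := by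
  have : (n : ℝ) ≠ 0 := by positivity
  rw [avg, Finset.sum_sub_distrib]
  field_simp
  simp

/-- Hoeffding's bound for the upper tail (`sg = 1`) or the lower tail (`sg = -1`). -/
theorem IsSubgaussian.measureReal_avg_ge (h : IsSubgaussian ν) (k : Fin 2) {n : ℕ} (hn : 1 ≤ n)
    {r : ℝ} (hr : 0 ≤ r) {sg : ℝ} (hsg : sg ^ 2 = 1) :
    (tableLaw ν).real {x | r ≤ sg * (avg x k 0 n - mean ν k)} ≤ Real.exp (-(n * r ^ 2 / 2)) := by
  have hinj : Function.Injective fun i : ℕ => ((k, i) : Fin 2 × ℕ) := fun i j h => by simpa using h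
  have hi := ((iIndepFun_sub_mean (ν := ν)).precomp hinj).comp (fun _ y => sg * y)
    fun _ => by fun_prop
  have hn' : (0 : ℝ) < n := by positivity
  have h1 := HasSubgaussianMGF.measure_sum_range_ge_le_of_iIndepFun hi (c := 1) (n := n)
    (fun i _ => by
      exact hasSubgaussianMGF_mul_of_sq_eq_one (h.hasSubgaussianMGF (k, i)) hsg) (ε := n * r) (by positivity)
  refine (measureReal_mono ?_).trans (h1.trans_eq ?_)
  · intro x hx
    simp only [Set.mem_ofPred_eq, Function.comp] at hx ⊢
    rw [avg_sub_mean x k 0 hn, ← mul_div_assoc, le_div_iff₀ hn', Finset.mul_sum] at hx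
    simpa [mul_comm] using hx
  · congr 1
    simp only [NNReal.coe_one]
    field_simp

theorem IsSubgaussian.measureReal_abs_avg_ge (h : IsSubgaussian ν) (k : Fin 2) {n : ℕ}
    (hn : 1 ≤ n) {r : ℝ} (hr : 0 ≤ r) :
    (tableLaw ν).real {x | r ≤ |avg x k 0 n - mean ν k|} ≤ 2 * Real.exp (-(n * r ^ 2 / 2)) := by
  have h1 := h.measureReal_avg_ge k hn hr (sg := 1) (by norm_num)
  have h2 := h.measureReal_avg_ge k hn hr (sg := -1) (by norm_num)
  calc _ ≤ (tableLaw ν).real ({x | r ≤ 1 * (avg x k 0 n - mean ν k)}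
        ∪ {x | r ≤ -1 * (avg x k 0 n - mean ν k)}) := by
        refine measureReal_mono fun x hx => ?_
        rcases le_abs.1 (Set.mem_ofPred_eq ▸ hx) with h | h
        · left; simpa using h
        · right; simpa using h
    _ ≤ _ := (measureReal_union_le _ _).trans (by linarith)

/-- The difference of the centred walks of the two arms, rewards taken alternately from arm `g`
and from the other arm, is a walk with `1`-subgaussian steps; this is its maximal inequality. -/
theorem IsSubgaussian.measureReal_exists_diff_ge (h : IsSubgaussian ν) {g g' : Fin 2}
    (hg : g ≠ g') {n : ℕ} (hn : 1 ≤ n) {a : ℝ} (ha : 0 ≤ a) :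
    (tableLaw ν).real {x | ∃ s, 1 ≤ s ∧ s ≤ n ∧ a ≤
      s * ((avg x g' 0 s - avg x g 0 s) - (mean ν g' - mean ν g))}
      ≤ Real.exp (-(a ^ 2 / (4 * n))) := by
  let e : ℕ → Fin 2 × ℕ := fun i => (if Even i then g else g', i / 2)
  let c : ℕ → ℝ := fun i => if Even i then -1 else 1
  have hinj : Function.Injective e := by
    intro i j hij
    simp only [e, Prod.mk.injEq] at hij
    obtain ⟨h1, h2⟩ := hij
    rcases Nat.even_or_odd i with hi | hi <;> rcases Nat.even_or_odd j with hj | hj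
    · obtain ⟨a, rfl⟩ := hi; obtain ⟨b, rfl⟩ := hj; omega
    · simp [hi, Nat.not_even_iff_odd.2 hj, hg] at h1
    · simp [hj, Nat.not_even_iff_odd.2 hi, hg.symm] at h1
    · obtain ⟨a, rfl⟩ := hi; obtain ⟨b, rfl⟩ := hj; omega
  have hcc : ∀ i, c i ^ 2 = 1 := fun i => by
    simp only [c]; split_ifs <;> norm_num
  have hi := ((iIndepFun_sub_mean (ν := ν)).precomp hinj).comp (fun i y => c i * y)
    fun _ => by fun_prop
  have h1 := measureReal_exists_sum_ge_le (c := 1) one_pos (fun i => by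
      simp only [Function.comp_def]; fun_prop) hi (fun i => by
      exact hasSubgaussianMGF_mul_of_sq_eq_one (h.hasSubgaussianMGF (e i)) (hcc i)) (fun i => by
      simp only [Function.comp_def, integral_const_mul]
      rw [h.integral_sub_mean (e i), mul_zero]) (n := 2 * n) ha (by omega)
  refine (measureReal_mono ?_).trans (h1.trans_eq ?_)
  · rintro x ⟨s, hs1, hs2, hs3⟩
    refine ⟨2 * s, by omega, by omega, hs3.trans_eq ?_⟩
    have hsum : ∀ s : ℕ, ∑ i ∈ Finset.range (2 * s), c i * (x (e i) - mean ν (e i).1)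
        = ∑ i ∈ Finset.range s, (x (g', i) - mean ν g')
          - ∑ i ∈ Finset.range s, (x (g, i) - mean ν g) := by
      intro s
      induction s with
      | zero => simp
      | succ s ih =>
        rw [show 2 * (s + 1) = 2 * s + 1 + 1 by ring, Finset.sum_range_succ,
          Finset.sum_range_succ, ih, Finset.sum_range_succ, Finset.sum_range_succ]
        have h1 : e (2 * s) = (g, s) := by simp [e]
        have h2 : e (2 * s + 1) = (g', s) := by
          simp only [e, Prod.mk.injEq]
          exact ⟨by simp, by omega⟩
        have h3 : c (2 * s) = -1 := by simp [c]
        have h4 : c (2 * s + 1) = 1 := by simp [c]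
        rw [h1, h2, h3, h4]
        ring
    have hs' : (s : ℝ) ≠ 0 := by positivity
    refine Eq.trans ?_ (hsum s).symm
    have h5 : (avg x g' 0 s - avg x g 0 s) - (mean ν g' - mean ν g)
        = (avg x g' 0 s - mean ν g') - (avg x g 0 s - mean ν g) := by ring
    rw [h5, avg_sub_mean x g' 0 hs1, avg_sub_mean x g 0 hs1]
    field_simp
    simp
  · congr 1
    push_cast
    field_simp
    norm_num

end Tails

/-! ### The stages of the algorithm as stopping rules -/

theorem find_congr_of_le {p q : ℕ → Prop} [DecidablePred p] [DecidablePred q]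
    (hp : ∃ n, p n) (hq : ∃ n, q n) (h : ∀ m ≤ Nat.find hp, p m ↔ q m) :
    Nat.find hq = Nat.find hp := by
  rw [Nat.find_eq_iff]
  exact ⟨(h _ le_rfl).1 (Nat.find_spec hp),
    fun n hn => fun hq => Nat.find_min hp hn ((h n hn.le).2 hq)⟩

theorem lt_find_congr {p q : ℕ → Prop} [DecidablePred p] [DecidablePred q]
    (hp : ∃ n, p n) (hq : ∃ n, q n) {s : ℕ} (hs : s < Nat.find hp) (h : ∀ m ≤ s, p m ↔ q m) :
    s < Nat.find hq := by
  rw [Nat.lt_find_iff]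
  exact fun m hm hqm => Nat.find_min hp (hm.trans_lt hs) ((h m hm).2 hqm)

theorem eq_or_eq_other (k a : Fin 2) : k = a ∨ k = other a := by
  fin_cases k <;> fin_cases a <;> simp [other]

theorem other_ne (a : Fin 2) : other a ≠ a := by
  fin_cases a <;> simp [other]

theorem other_other (a : Fin 2) : other (other a) = a := by
  fin_cases a <;> simp [other]

theorem avg_congr {x y : Rewards} {k : Fin 2} {a n : ℕ}
    (h : ∀ i < a + n, x (k, i) = y (k, i)) : avg x k a n = avg y k a n := by
  unfold avg
  congr 1
  exact Finset.sum_congr rfl fun i hi => h _ (by have := Finset.mem_range.1 hi; omega)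

theorem avg_shift (m : Fin 2 → ℕ) (x : Rewards) (k : Fin 2) (a n : ℕ) :
    avg (shift m x) k a n = avg x k (m k + a) n := by
  simp [avg, shift, add_assoc]

theorem one_le_τ₁ (T₁ : ℝ) (x : Rewards) : 1 ≤ τ₁ T₁ x := by
  classical
  exact (Nat.find_spec (exists_stop₁ T₁ x)).1

theorem stop₁_congr {T₁ : ℝ} {x y : Rewards} {s : ℕ}
    (h : Agree (fun _ => s) x y) : Stop₁ T₁ x s ↔ Stop₁ T₁ y s := by
  unfold Stop₁
  rw [avg_congr (a := 0) fun i hi => h 0 i (by simpa using hi),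
    avg_congr (a := 0) fun i hi => h 1 i (by simpa using hi)]

theorem Agree.mono {m n : Fin 2 → ℕ} {x y : Rewards} (h : Agree n x y) (hmn : ∀ k, m k ≤ n k) :
    Agree m x y := fun k i hi => h k i (hi.trans_le (hmn k))

theorem Agree.symm {n : Fin 2 → ℕ} {x y : Rewards} (h : Agree n x y) : Agree n y x :=
  fun k i hi => (h k i hi).symm

open Classical in
theorem τ₁_congr {T₁ : ℝ} {x y : Rewards} (h : Agree (fun _ => τ₁ T₁ x) x y) :
    τ₁ T₁ y = τ₁ T₁ x :=
  find_congr_of_le _ _ fun _ hm => stop₁_congr (h.mono fun _ => hm)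

open Classical in
theorem lt_τ₁_congr {T₁ : ℝ} {x y : Rewards} {s : ℕ} (hs : s < τ₁ T₁ x)
    (h : Agree (fun _ => s) x y) : s < τ₁ T₁ y :=
  lt_find_congr _ _ hs fun _ hm => stop₁_congr (h.mono fun _ => hm)

theorem lead_congr {T₁ : ℝ} {b : Fin 2} {x y : Rewards} (h : Agree (fun _ => τ₁ T₁ x) x y) :
    lead T₁ b y = lead T₁ b x := by
  unfold lead
  rw [τ₁_congr h, ← avg_congr (a := 0) fun i hi => h 0 i (by simpa using hi),
    ← avg_congr (a := 0) fun i hi => h 1 i (by simpa using hi)]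

theorem rest_congr {T₁ : ℝ} {b : Fin 2} {x y : Rewards} (h : Agree (fun _ => τ₁ T₁ x) x y) :
    rest T₁ b y = rest T₁ b x := by
  unfold rest
  rw [lead_congr h]

/-- The number of pulls of each arm after `n` steps of Stage III. -/
noncomputable def stagePulls (T₁ : ℝ) (b : Fin 2) (x : Rewards) (n : ℕ) (k : Fin 2) : ℕ :=
  if k = lead T₁ b x then pulls₂ T₁ x else τ₁ T₁ x + n

theorem τ₁_le_pulls₂ (T₁ : ℝ) (x : Rewards) : τ₁ T₁ x ≤ pulls₂ T₁ x := le_max_left _ _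

theorem τ₁_le_stagePulls (T₁ : ℝ) (b : Fin 2) (x : Rewards) (n : ℕ) (k : Fin 2) :
    τ₁ T₁ x ≤ stagePulls T₁ b x n k := by
  unfold stagePulls
  split_ifs
  · exact τ₁_le_pulls₂ T₁ x
  · omega

theorem stagePulls_mono (T₁ : ℝ) (b : Fin 2) (x : Rewards) {m n : ℕ} (h : m ≤ n) (k : Fin 2) :
    stagePulls T₁ b x m k ≤ stagePulls T₁ b x n k := by
  unfold stagePulls
  split_ifs <;> omega

theorem pulls₂_congr {T₁ : ℝ} {x y : Rewards} (h : Agree (fun _ => τ₁ T₁ x) x y) :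
    pulls₂ T₁ y = pulls₂ T₁ x := by
  unfold pulls₂
  rw [τ₁_congr h]

theorem leadMean_congr {T₁ : ℝ} {b : Fin 2} {x y : Rewards} {n : ℕ}
    (h : Agree (stagePulls T₁ b x n) x y) : leadMean T₁ b y = leadMean T₁ b x := by
  have h' := h.mono (τ₁_le_stagePulls T₁ b x n)
  unfold leadMean
  rw [lead_congr h', pulls₂_congr h']
  refine (avg_congr fun i hi => h _ i ?_).symm
  simpa [stagePulls] using hi

theorem rest_ne_lead (T₁ : ℝ) (b : Fin 2) (x : Rewards) : rest T₁ b x ≠ lead T₁ b x :=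
  other_ne _

theorem θ_congr {T₁ : ℝ} {b : Fin 2} {x y : Rewards} {n : ℕ}
    (h : Agree (stagePulls T₁ b x n) x y) : θ T₁ b y n = θ T₁ b x n := by
  have h' := h.mono (τ₁_le_stagePulls T₁ b x n)
  unfold θ
  rw [rest_congr h', τ₁_congr h']
  refine (avg_congr fun i hi => h _ i ?_).symm
  simpa [stagePulls, rest_ne_lead] using hi

theorem stop₃_congr {T : ℕ} {T₁ : ℝ} {b : Fin 2} {x y : Rewards} {n : ℕ}
    (h : Agree (stagePulls T₁ b x n) x y) : Stop₃ T T₁ b x n ↔ Stop₃ T T₁ b y n := by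
  unfold Stop₃
  rw [leadMean_congr h, θ_congr h]

open Classical in
theorem t₂_congr {T : ℕ} {T₁ : ℝ} {b : Fin 2} {x y : Rewards}
    (h : Agree (stagePulls T₁ b x (t₂ T T₁ b x)) x y) : t₂ T T₁ b y = t₂ T T₁ b x :=
  find_congr_of_le _ _ fun _ hm => stop₃_congr (h.mono (stagePulls_mono T₁ b x hm))

open Classical in
theorem lt_t₂_congr {T : ℕ} {T₁ : ℝ} {b : Fin 2} {x y : Rewards} {n : ℕ} (hn : n < t₂ T T₁ b x)
    (h : Agree (stagePulls T₁ b x n) x y) : n < t₂ T T₁ b y :=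
  lt_find_congr _ _ hn fun _ hm => stop₃_congr (h.mono (stagePulls_mono T₁ b x hm))

theorem pulls₃_eq_stagePulls (T : ℕ) (T₁ : ℝ) (b : Fin 2) (x : Rewards) :
    pulls₃ T T₁ b x = stagePulls T₁ b x (t₂ T T₁ b x) := rfl

theorem pulls₃_congr {T : ℕ} {T₁ : ℝ} {b : Fin 2} {x y : Rewards}
    (h : Agree (pulls₃ T T₁ b x) x y) : pulls₃ T T₁ b y = pulls₃ T T₁ b x := by
  rw [pulls₃_eq_stagePulls] at h
  have h' := h.mono (τ₁_le_stagePulls T₁ b x _)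
  funext k
  unfold pulls₃
  rw [lead_congr h', pulls₂_congr h', τ₁_congr h', t₂_congr h]

theorem commit_congr {T : ℕ} {T₁ : ℝ} {b : Fin 2} {x y : Rewards}
    (h : Agree (pulls₃ T T₁ b x) x y) : commit T T₁ b y = commit T T₁ b x := by
  rw [pulls₃_eq_stagePulls] at h
  have h' := h.mono (τ₁_le_stagePulls T₁ b x _)
  unfold commit
  rw [t₂_congr h, θ_congr h, leadMean_congr h, lead_congr h', rest_congr h']

theorem time₃_congr {T : ℕ} {T₁ : ℝ} {b : Fin 2} {x y : Rewards}
    (h : Agree (pulls₃ T T₁ b x) x y) : time₃ T T₁ b y = time₃ T T₁ b x := by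
  rw [pulls₃_eq_stagePulls] at h
  have h' := h.mono (τ₁_le_stagePulls T₁ b x _)
  unfold time₃
  rw [t₂_congr h, τ₁_congr h', pulls₂_congr h']

/-! The second uniform exploration is the first one, with the parameter `2 * T`, run on the rewards
that Stages I, II and III leave over. -/

theorem p_eq (T : ℕ) (T₁ : ℝ) (b : Fin 2) (x : Rewards) (k : Fin 2) (s : ℕ) :
    p T T₁ b x k s = avg (shift (pulls₃ T T₁ b x) x) k 0 s := by
  rw [avg_shift]
  rfl

theorem stop₄_iff (T : ℕ) (T₁ : ℝ) (b : Fin 2) (x : Rewards) (s : ℕ) :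
    Stop₄ T T₁ b x s ↔ Stop₁ (2 * T) (shift (pulls₃ T T₁ b x) x) s := by
  unfold Stop₄ Stop₁
  rw [p_eq, p_eq]
  have h1 : (16 : ℝ) / (2 * s) = 8 / s := by
    rw [show (16 : ℝ) = 2 * 8 by norm_num]
    exact mul_div_mul_left _ _ two_ne_zero
  have h2 : (2 * T : ℝ) / (2 * s) = T / s := mul_div_mul_left _ _ two_ne_zero
  rw [h1, h2]

open Classical in
theorem τ₃_eq (T : ℕ) (T₁ : ℝ) (b : Fin 2) (x : Rewards) :
    τ₃ T T₁ b x = τ₁ (2 * T) (shift (pulls₃ T T₁ b x) x) :=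
  (find_congr_of_le _ _ fun m _ => stop₄_iff T T₁ b x m).symm

theorem commit'_eq (T : ℕ) (T₁ : ℝ) (b : Fin 2) (x : Rewards) :
    commit' T T₁ b x = lead (2 * T) b (shift (pulls₃ T T₁ b x) x) := by
  unfold commit' lead
  rw [p_eq, p_eq, τ₃_eq]

theorem θ_eq (T₁ : ℝ) (b : Fin 2) (x : Rewards) (n : ℕ) :
    θ T₁ b x n = avg (shift (fun _ => τ₁ T₁ x) x) (rest T₁ b x) 0 n := by
  rw [avg_shift]
  rfl

theorem agree_shift {m : Fin 2 → ℕ} {x y : Rewards} {s : ℕ}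
    (h : Agree (fun k => m k + s) x y) : Agree (fun _ => s) (shift m x) (shift m y) :=
  fun k i hi => h k (m k + i) (by dsimp only at hi ⊢; omega)

/-! ### The number of pulls at the ends of the stages -/

section Pulls

variable (T : ℕ) (T₁ : ℝ) (b : Fin 2) (x : Rewards)

theorem pulls_succ (k : Fin 2) (t : ℕ) :
    pulls T T₁ b x k (t + 1) = pulls T T₁ b x k t + if arm T T₁ b x t = k then 1 else 0 := by
  unfold pulls
  rw [Finset.range_add_one, Finset.filter_insert]
  split_ifs with h
  · rw [Finset.card_insert_of_notMem (by simp)]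
  · rfl

theorem pulls_mono (k : Fin 2) : Monotone (pulls T T₁ b x k) :=
  monotone_nat_of_le_succ fun t => by rw [pulls_succ]; omega

theorem pulls_le (k : Fin 2) (t : ℕ) : pulls T T₁ b x k t ≤ t := by
  unfold pulls
  exact (Finset.card_filter_le _ _).trans (by simp)

theorem pulls_add_pulls_other (k : Fin 2) (t : ℕ) :
    pulls T T₁ b x k t + pulls T T₁ b x (other k) t = t := by
  induction t with
  | zero => simp [pulls]
  | succ t ih =>
    rw [pulls_succ, pulls_succ]
    rcases eq_or_eq_other (arm T T₁ b x t) k with h | h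
    · rw [if_pos h, if_neg (by rw [h]; exact (other_ne k).symm)]
      omega
    · rw [if_pos h, if_neg (by rw [h]; exact other_ne k)]
      omega

theorem pulls_add_of_arm_eq {t n : ℕ} {a : Fin 2} (h : ∀ i < n, arm T T₁ b x (t + i) = a)
    (k : Fin 2) : pulls T T₁ b x k (t + n) = pulls T T₁ b x k t + if k = a then n else 0 := by
  induction n with
  | zero => simp
  | succ n ih =>
    rw [← add_assoc, pulls_succ, ih fun i hi => h i (by omega), h n (by omega)]
    by_cases hk : k = a
    · simp [hk, add_assoc]
    · simp [hk, Ne.symm hk]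

theorem pulls_add_of_alternate {t s : ℕ} (h : ∀ i < 2 * s, arm T T₁ b x (t + i) = alternate i)
    (k : Fin 2) : pulls T T₁ b x k (t + 2 * s) = pulls T T₁ b x k t + s := by
  induction s with
  | zero => simp
  | succ s ih =>
    rw [show t + 2 * (s + 1) = t + 2 * s + 1 + 1 by ring, pulls_succ, pulls_succ,
      ih fun i hi => h i (by omega), h _ (by omega), add_assoc t (2 * s) 1, h _ (by omega)]
    have h1 : alternate (2 * s) = 0 := by simp [alternate]
    have h2 : alternate (2 * s + 1) = 1 := by simp [alternate]
    rw [h1, h2]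
    fin_cases k <;> simp <;> omega

theorem arm_of_lt_two_mul {t : ℕ} (h : t < 2 * τ₁ T₁ x) : arm T T₁ b x t = alternate t := by
  unfold arm
  rw [if_pos h]

theorem pulls_two_mul {s : ℕ} (h : s ≤ τ₁ T₁ x) (k : Fin 2) : pulls T T₁ b x k (2 * s) = s := by
  have := pulls_add_of_alternate T T₁ b x (t := 0) (s := s)
    (fun i hi => by rw [zero_add]; exact arm_of_lt_two_mul T T₁ b x (by omega)) k
  simpa [pulls] using this

theorem pulls_stage₂ (k : Fin 2) : pulls T T₁ b x k (τ₁ T₁ x + pulls₂ T₁ x)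
    = stagePulls T₁ b x 0 k := by
  have h := τ₁_le_pulls₂ T₁ x
  have h1 := pulls_add_of_arm_eq T T₁ b x (t := 2 * τ₁ T₁ x) (n := pulls₂ T₁ x - τ₁ T₁ x)
    (a := lead T₁ b x) (fun i hi => by
      unfold arm
      rw [if_neg (by omega), if_pos (by omega)]) k
  rw [show 2 * τ₁ T₁ x + (pulls₂ T₁ x - τ₁ T₁ x) = τ₁ T₁ x + pulls₂ T₁ x by omega] at h1
  rw [h1, pulls_two_mul T T₁ b x le_rfl]
  unfold stagePulls
  split_ifs <;> omega

theorem pulls_stage₃ {n : ℕ} (hn : n ≤ t₂ T T₁ b x) (k : Fin 2) :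
    pulls T T₁ b x k (τ₁ T₁ x + pulls₂ T₁ x + n) = stagePulls T₁ b x n k := by
  have h := τ₁_le_pulls₂ T₁ x
  have h1 := pulls_add_of_arm_eq T T₁ b x (t := τ₁ T₁ x + pulls₂ T₁ x) (n := n)
    (a := rest T₁ b x) (fun i hi => by
      unfold arm time₃
      rw [if_neg (by omega), if_neg (by omega), if_pos (by omega)]) k
  rw [h1, pulls_stage₂]
  unfold stagePulls
  rcases eq_or_eq_other k (lead T₁ b x) with hk | hk
  · rw [if_pos hk, if_pos hk, if_neg (by rw [hk]; exact (rest_ne_lead T₁ b x).symm), add_zero]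
  · have hk' : k = rest T₁ b x := hk
    have hk'' : k ≠ lead T₁ b x := by rw [hk']; exact rest_ne_lead T₁ b x
    rw [if_neg hk'', if_neg hk'', if_pos hk', add_zero]

theorem pulls_time₃ (k : Fin 2) : pulls T T₁ b x k (time₃ T T₁ b x) = pulls₃ T T₁ b x k :=
  pulls_stage₃ T T₁ b x le_rfl k

theorem two_mul_τ₁_le_time₃ : τ₁ T₁ x + pulls₂ T₁ x ≤ time₃ T T₁ b x ∧
    2 * τ₁ T₁ x ≤ time₃ T T₁ b x := by
  have h := τ₁_le_pulls₂ T₁ x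
  unfold time₃
  omega

theorem pulls_of_commit (h : (t₂ T T₁ b x : ℝ) < Real.log T ^ 2) (n : ℕ) (k : Fin 2) :
    pulls T T₁ b x k (time₃ T T₁ b x + n)
      = pulls₃ T T₁ b x k + if k = commit T T₁ b x then n else 0 := by
  have h' := two_mul_τ₁_le_time₃ T T₁ b x
  rw [pulls_add_of_arm_eq T T₁ b x (a := commit T T₁ b x) (fun i hi => by
      unfold arm
      rw [if_neg (by omega), if_neg (by omega), if_neg (by omega), if_pos h]) k, pulls_time₃]

theorem pulls_of_explore (h : ¬ (t₂ T T₁ b x : ℝ) < Real.log T ^ 2) {s : ℕ}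
    (hs : s ≤ τ₃ T T₁ b x) (k : Fin 2) :
    pulls T T₁ b x k (time₃ T T₁ b x + 2 * s) = pulls₃ T T₁ b x k + s := by
  have h' := two_mul_τ₁_le_time₃ T T₁ b x
  rw [pulls_add_of_alternate T T₁ b x (fun i hi => by
      unfold arm
      rw [if_neg (by omega), if_neg (by omega), if_neg (by omega), if_neg h, if_pos (by omega),
        Nat.add_sub_cancel_left]) k, pulls_time₃]

theorem pulls_of_commit' (h : ¬ (t₂ T T₁ b x : ℝ) < Real.log T ^ 2) (n : ℕ) (k : Fin 2) :
    pulls T T₁ b x k (time₃ T T₁ b x + 2 * τ₃ T T₁ b x + n)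
      = pulls₃ T T₁ b x k + τ₃ T T₁ b x + if k = commit' T T₁ b x then n else 0 := by
  have h' := two_mul_τ₁_le_time₃ T T₁ b x
  rw [pulls_add_of_arm_eq T T₁ b x (a := commit' T T₁ b x) (fun i hi => by
      unfold arm
      rw [if_neg (by omega), if_neg (by omega), if_neg (by omega), if_neg h, if_neg (by omega)]) k,
    pulls_of_explore T T₁ b x h le_rfl]

open Classical in
/-- Where the pulls of arm `k` up to the horizon come from: Stage I, Stage II (if arm `k` leads),
Stage III, the commitment after Stage III, the second exploration and the commitment after it. -/
theorem pulls_le_add (k : Fin 2) :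
    pulls T T₁ b x k T ≤ τ₁ T₁ x + (if lead T₁ b x = k then pulls₂ T₁ x else 0) + t₂ T T₁ b x
      + (if (t₂ T T₁ b x : ℝ) < Real.log T ^ 2 ∧ commit T T₁ b x = k then T else 0)
      + (if Real.log T ^ 2 ≤ t₂ T T₁ b x then
          τ₃ T T₁ b x + if commit' T T₁ b x = k then T else 0 else 0) := by
  have h3 : pulls₃ T T₁ b x k
      ≤ τ₁ T₁ x + (if lead T₁ b x = k then pulls₂ T₁ x else 0) + t₂ T T₁ b x := by
    unfold pulls₃
    by_cases hk : k = lead T₁ b x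
    · simp only [hk, if_true]; omega
    · simp only [hk, Ne.symm hk, if_false]; omega
  generalize τ₁ T₁ x + (if lead T₁ b x = k then pulls₂ T₁ x else 0) + t₂ T T₁ b x = m at h3 ⊢
  by_cases h : (t₂ T T₁ b x : ℝ) < Real.log T ^ 2
  · have h1 := (pulls_mono T T₁ b x k (Nat.le_add_left T (time₃ T T₁ b x))).trans_eq
      (pulls_of_commit T T₁ b x h T k)
    rw [if_neg (not_le.2 h)]
    by_cases hk : commit T T₁ b x = k
    · rw [if_pos ⟨h, hk⟩]
      rw [if_pos hk.symm] at h1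
      omega
    · rw [if_neg (fun h => hk h.2)]
      rw [if_neg (Ne.symm hk)] at h1
      omega
  · have h1 := (pulls_mono T T₁ b x k
      (Nat.le_add_left T (time₃ T T₁ b x + 2 * τ₃ T T₁ b x))).trans_eq
      (pulls_of_commit' T T₁ b x h T k)
    rw [if_neg (fun h' => h h'.1), if_pos (not_lt.1 h)]
    by_cases hk : commit' T T₁ b x = k
    · rw [if_pos hk]
      rw [if_pos hk.symm] at h1
      omega
    · rw [if_neg hk]
      rw [if_neg (Ne.symm hk)] at h1
      omega

theorem t₂_le_pulls (h : time₃ T T₁ b x ≤ T) {k : Fin 2} (hk : lead T₁ b x ≠ k) :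
    t₂ T T₁ b x ≤ pulls T T₁ b x k T := by
  refine le_trans ?_ (pulls_mono T T₁ b x k h)
  rw [pulls_time₃, pulls₃, if_neg (Ne.symm hk)]
  omega

/-! ### The algorithm does not look into the future -/

variable {x} in
/-- The arm pulled next is a function of the rewards received so far. -/
theorem arm_congr {y : Rewards} {t : ℕ} (h : Agree (fun k => pulls T T₁ b x k t) x y) :
    arm T T₁ b y t = arm T T₁ b x t := by
  by_cases h1 : t < 2 * τ₁ T₁ x
  · have h2 : t / 2 < τ₁ T₁ y := by
      refine lt_τ₁_congr (x := x) (by omega) (h.mono fun k => ?_)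
      rw [← pulls_two_mul T T₁ b x (s := t / 2) (by omega) k]
      exact pulls_mono T T₁ b x k (by omega)
    rw [arm_of_lt_two_mul T T₁ b x h1, arm_of_lt_two_mul T T₁ b y (by omega)]
  have hτ : Agree (fun _ => τ₁ T₁ x) x y := h.mono fun k => by
    rw [← pulls_two_mul T T₁ b x le_rfl k]
    exact pulls_mono T T₁ b x k (by omega)
  have e1 := τ₁_congr hτ
  have e2 := lead_congr (b := b) hτ
  have e3 := pulls₂_congr hτ
  have e4 := rest_congr (b := b) hτ
  by_cases h2 : t < τ₁ T₁ x + pulls₂ T₁ x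
  · unfold arm
    rw [e1, e2, e3, if_neg h1, if_pos h2, if_neg h1, if_pos h2]
  by_cases h3 : t < time₃ T T₁ b x
  · set n := t - (τ₁ T₁ x + pulls₂ T₁ x) with hn
    have hn' : n < t₂ T T₁ b x := by unfold time₃ at h3; omega
    have h4 : n < t₂ T T₁ b y := lt_t₂_congr hn' <| h.mono fun k => by
      rw [← pulls_stage₃ T T₁ b x hn'.le k]
      exact pulls_mono T T₁ b x k (by omega)
    unfold arm time₃
    unfold time₃ at h3
    rw [e1, e3, e4, if_neg h1, if_neg h2, if_neg h1, if_neg h2, if_pos h3, if_pos (by omega)]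
  have h₃ : Agree (pulls₃ T T₁ b x) x y := h.mono fun k => by
    rw [← pulls_time₃ T T₁ b x k]
    exact pulls_mono T T₁ b x k (by omega)
  have e5 := time₃_congr h₃
  have e6 := t₂_congr (T := T) (b := b) (T₁ := T₁) h₃
  have e7 := commit_congr h₃
  have e8 := pulls₃_congr h₃
  by_cases h4 : (t₂ T T₁ b x : ℝ) < Real.log T ^ 2
  · unfold arm
    rw [e1, e3, e5, e6, e7, if_neg h1, if_neg h2, if_neg h3, if_pos h4, if_neg h1, if_neg h2,
      if_neg h3, if_pos h4]
  by_cases h5 : t < time₃ T T₁ b x + 2 * τ₃ T T₁ b x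
  · set s := (t - time₃ T T₁ b x) / 2 with hs
    have hs' : s < τ₃ T T₁ b x := by omega
    have h6 : s < τ₃ T T₁ b y := by
      rw [τ₃_eq] at hs' ⊢
      rw [e8]
      refine lt_τ₁_congr hs' (agree_shift (h.mono fun k => ?_))
      rw [← pulls_of_explore T T₁ b x h4 (s := s) (by omega) k]
      exact pulls_mono T T₁ b x k (by omega)
    unfold arm
    rw [e1, e3, e5, e6, if_neg h1, if_neg h2, if_neg h3, if_neg h4, if_pos h5, if_neg h1, if_neg h2,
      if_neg h3, if_neg h4, if_pos (by omega)]
  · have h6 : Agree (fun _ => τ₁ (2 * T) (shift (pulls₃ T T₁ b x) x))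
        (shift (pulls₃ T T₁ b x) x) (shift (pulls₃ T T₁ b x) y) := by
      refine agree_shift (h.mono fun k => ?_)
      rw [← τ₃_eq, ← pulls_of_explore T T₁ b x h4 le_rfl k]
      exact pulls_mono T T₁ b x k (by omega)
    have e9 : τ₃ T T₁ b y = τ₃ T T₁ b x := by rw [τ₃_eq, τ₃_eq, e8, τ₁_congr h6]
    have e10 : commit' T T₁ b y = commit' T T₁ b x := by
      rw [commit'_eq, commit'_eq, e8, lead_congr h6]
    unfold arm
    rw [e1, e3, e5, e6, e9, e10, if_neg h1, if_neg h2, if_neg h3, if_neg h4, if_neg h5, if_neg h1,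
      if_neg h2, if_neg h3, if_neg h4]

variable {x} in
theorem pulls_congr {y : Rewards} {t : ℕ} (h : Agree (fun k => pulls T T₁ b x k t) x y)
    (k : Fin 2) : pulls T T₁ b y k t = pulls T T₁ b x k t := by
  induction t with
  | zero => simp [pulls]
  | succ t ih =>
    have h' : Agree (fun k => pulls T T₁ b x k t) x y :=
      h.mono fun k => pulls_mono T T₁ b x k t.le_succ
    rw [pulls_succ, pulls_succ, ih h', arm_congr T T₁ b h']

theorem dependsOn_lt_pulls (j : Fin 2 × ℕ) (t : ℕ) :
    DependsOn (fun x : Rewards => x ∈ {x | j.2 < pulls T T₁ b x j.1 t}) {j}ᶜ := by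
  have key : ∀ x y : Rewards, (∀ i ∈ ({j}ᶜ : Set (Fin 2 × ℕ)), x i = y i) →
      ¬ j.2 < pulls T T₁ b x j.1 t → ¬ j.2 < pulls T T₁ b y j.1 t := by
    intro x y hxy hx
    rwa [pulls_congr T T₁ b (x := x) (y := y)]
    intro k i hi
    refine hxy (k, i) fun hj => ?_
    rw [Set.mem_singleton_iff] at hj
    subst hj
    exact hx hi
  intro x y hxy
  refine propext (not_iff_not.1 ⟨key x y hxy, key y x fun i hi => (hxy i hi).symm⟩)

theorem totalReward_eq_sum_pulls (t : ℕ) : ∑ i ∈ Finset.range t, reward T T₁ b x i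
    = ∑ k, ∑ i ∈ Finset.range (pulls T T₁ b x k t), x (k, i) := by
  induction t with
  | zero => simp [pulls]
  | succ t ih =>
    rw [Finset.sum_range_succ, ih, Fin.sum_univ_two, Fin.sum_univ_two, reward, pulls_succ,
      pulls_succ]
    rcases eq_or_eq_other (arm T T₁ b x t) 0 with h | h <;> rw [h]
    · simp [Finset.sum_range_succ]; ring
    · simp [other, Finset.sum_range_succ]; ring

end Pulls

/-! ### Measurability -/

theorem measurable_avg (k : Fin 2) (a n : ℕ) : Measurable fun x : Rewards => avg x k a n := by
  unfold avg
  exact (Finset.measurable_fun_sum (Finset.range n) fun i _ =>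
    measurable_pi_apply (k, a + i)).div_const (n : ℝ)

theorem measurable_avg_comp {K : Rewards → Fin 2} {A M : Rewards → ℕ} (hK : Measurable K)
    (hA : Measurable A) (hM : Measurable M) :
    Measurable fun x => avg x (K x) (A x) (M x) := by
  have h : Measurable fun q : Rewards × (Fin 2 × ℕ × ℕ) => avg q.1 q.2.1 q.2.2.1 q.2.2.2 :=
    measurable_from_prod_countable_left fun q => measurable_avg q.1 q.2.1 q.2.2
  exact h.comp (measurable_id.prodMk (hK.prodMk (hA.prodMk hM)))

theorem measurable_argmax (b : Fin 2) {u v : Rewards → ℝ} (hu : Measurable u)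
    (hv : Measurable v) : Measurable fun x => argmax b (u x) (v x) := by
  unfold argmax
  exact Measurable.ite (measurableSet_lt hv hu) measurable_const
    (Measurable.ite (measurableSet_lt hu hv) measurable_const measurable_const)

section Measurability

variable (T : ℕ) (T₁ : ℝ) (b : Fin 2)

open Classical in
theorem measurable_τ₁ : Measurable (τ₁ T₁) := by
  refine measurable_find (exists_stop₁ T₁) fun s => ?_
  have h : Measurable fun x : Rewards => |avg x 0 0 s - avg x 1 0 s| :=
    ((measurable_avg_comp measurable_const measurable_const measurable_const).sub
      (measurable_avg_comp measurable_const measurable_const measurable_const)).abs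
  exact (MeasurableSet.const _).inter (measurableSet_lt h measurable_const).compl

theorem measurable_lead : Measurable (lead T₁ b) := by
  have h := measurable_τ₁ T₁
  exact measurable_argmax b (measurable_avg_comp measurable_const measurable_const h)
    (measurable_avg_comp measurable_const measurable_const h)

theorem measurable_rest : Measurable (rest T₁ b) :=
  (measurable_of_countable other).comp (measurable_lead T₁ b)

theorem measurable_pulls₂ : Measurable (pulls₂ T₁) :=
  (measurable_τ₁ T₁).max measurable_const

theorem measurable_leadMean : Measurable (leadMean T₁ b) :=
  measurable_avg_comp (measurable_lead T₁ b) measurable_const (measurable_pulls₂ T₁)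

theorem measurable_θ {M : Rewards → ℕ} (hM : Measurable M) :
    Measurable fun x => θ T₁ b x (M x) :=
  measurable_avg_comp (measurable_rest T₁ b) (measurable_τ₁ T₁) hM

open Classical in
theorem measurable_t₂ : Measurable (t₂ T T₁ b) := by
  refine measurable_find (exists_stop₃ T T₁ b) fun n => ?_
  have h : Measurable fun x : Rewards => |leadMean T₁ b x - θ T₁ b x n| :=
    ((measurable_leadMean T₁ b).sub (measurable_θ T₁ b measurable_const)).abs
  exact (MeasurableSet.const _).inter
    (((measurableSet_lt h measurable_const).inter (MeasurableSet.const _)).compl)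

theorem measurable_commit : Measurable (commit T T₁ b) :=
  Measurable.ite (measurableSet_le (measurable_θ T₁ b (measurable_t₂ T T₁ b))
    (measurable_leadMean T₁ b)) (measurable_lead T₁ b) (measurable_rest T₁ b)

theorem measurable_pulls₃ : Measurable (pulls₃ T T₁ b) := by
  refine measurable_pi_lambda _ fun k => ?_
  exact Measurable.ite (measurableSet_eq_fun measurable_const (measurable_lead T₁ b))
    (measurable_pulls₂ T₁) ((measurable_τ₁ T₁).add (measurable_t₂ T T₁ b))

/-- The end of Stage I, as a stopping rule. -/
theorem isStoppingRule_τ₁ : IsStoppingRule fun x _ => τ₁ T₁ x where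
  measurable := measurable_pi_lambda _ fun _ => measurable_τ₁ T₁
  eq_of_agree _ _ h := funext fun _ => τ₁_congr h

/-- The end of Stage III, as a stopping rule. -/
theorem isStoppingRule_pulls₃ : IsStoppingRule (pulls₃ T T₁ b) where
  measurable := measurable_pulls₃ T T₁ b
  eq_of_agree _ _ h := pulls₃_congr h

theorem measurable_τ₃ : Measurable (τ₃ T T₁ b) := by
  have : τ₃ T T₁ b = fun x => τ₁ (2 * T) (shift (pulls₃ T T₁ b x) x) :=
    funext fun x => τ₃_eq T T₁ b x
  rw [this]
  exact (measurable_τ₁ _).comp (measurable_shift_stoppingRule (measurable_pulls₃ T T₁ b))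

theorem measurable_commit' : Measurable (commit' T T₁ b) := by
  have : commit' T T₁ b = fun x => lead (2 * T) b (shift (pulls₃ T T₁ b x) x) :=
    funext fun x => commit'_eq T T₁ b x
  rw [this]
  exact (measurable_lead _ b).comp (measurable_shift_stoppingRule (measurable_pulls₃ T T₁ b))

theorem measurable_arm (t : ℕ) : Measurable fun x => arm T T₁ b x t := by
  have h3 : Measurable (time₃ T T₁ b) :=
    ((measurable_τ₁ T₁).add (measurable_pulls₂ T₁)).add (measurable_t₂ T T₁ b)
  have hcast : Measurable fun x => (t₂ T T₁ b x : ℝ) :=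
    measurable_from_nat.comp (measurable_t₂ T T₁ b)
  unfold arm
  refine Measurable.ite (measurableSet_lt measurable_const ((measurable_τ₁ T₁).const_mul 2))
    measurable_const ?_
  refine Measurable.ite (measurableSet_lt measurable_const
    ((measurable_τ₁ T₁).add (measurable_pulls₂ T₁))) (measurable_lead T₁ b) ?_
  refine Measurable.ite (measurableSet_lt measurable_const h3) (measurable_rest T₁ b) ?_
  refine Measurable.ite (measurableSet_lt hcast measurable_const) (measurable_commit T T₁ b) ?_
  exact Measurable.ite (measurableSet_lt measurable_const
    (h3.add ((measurable_τ₃ T T₁ b).const_mul 2)))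
    ((measurable_of_countable fun n => alternate (t - n)).comp h3) (measurable_commit' T T₁ b)

theorem measurable_pulls (k : Fin 2) (t : ℕ) : Measurable fun x => pulls T T₁ b x k t := by
  induction t with
  | zero => simp [pulls]
  | succ t ih =>
    simp only [pulls_succ]
    exact ih.add (Measurable.ite (measurableSet_eq_fun (measurable_arm T T₁ b t) measurable_const)
      measurable_const measurable_const)

end Measurability

/-! ### The regret as the expected number of pulls of the inferior arm -/

theorem integrable_natCast {P : Measure Rewards} [IsProbabilityMeasure P] {f : Rewards → ℕ}
    (hf : Measurable f) {M : ℕ} (hM : ∀ x, f x ≤ M) : Integrable (fun x => (f x : ℝ)) P := by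
  refine Integrable.of_bound (measurable_from_nat.comp hf).aestronglyMeasurable M
    (ae_of_all _ fun x => ?_)
  simpa using hM x

section Regret

variable (T : ℕ) (T₁ : ℝ) (b : Fin 2)

theorem totalReward_eq_sum_indicator (x : Rewards) : totalReward T T₁ b x
    = ∑ k, ∑ i ∈ Finset.range T,
      {x : Rewards | i < pulls T T₁ b x k T}.indicator (fun x => x (k, i)) x := by
  rw [totalReward, totalReward_eq_sum_pulls]
  refine Finset.sum_congr rfl fun k _ => ?_
  simp only [Set.indicator_apply]
  rw [← Finset.sum_filter]
  refine Finset.sum_congr ?_ fun _ _ => rfl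
  ext i
  have := pulls_le T T₁ b x k T
  simp
  omega

theorem measurableSet_lt_pulls (k : Fin 2) (i : ℕ) :
    MeasurableSet {x : Rewards | i < pulls T T₁ b x k T} :=
  measurableSet_lt measurable_const (measurable_pulls T T₁ b k T)

variable {ν : Fin 2 → Measure ℝ} [∀ k, IsProbabilityMeasure (ν k)]

theorem IsSubgaussian.integrable_indicator (h : IsSubgaussian ν) (k : Fin 2) (i : ℕ) :
    Integrable ({x : Rewards | i < pulls T T₁ b x k T}.indicator (fun x => x (k, i)))
      (tableLaw ν) :=
  (h.integrable_eval (k, i)).indicator (measurableSet_lt_pulls T T₁ b k i)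

theorem IsSubgaussian.integrable_totalReward (h : IsSubgaussian ν) :
    Integrable (totalReward T T₁ b) (tableLaw ν) := by
  have : totalReward T T₁ b = fun x => ∑ k, ∑ i ∈ Finset.range T,
      {x : Rewards | i < pulls T T₁ b x k T}.indicator (fun x => x (k, i)) x :=
    funext fun x => totalReward_eq_sum_indicator T T₁ b x
  rw [this]
  exact integrable_finsetSum _ fun k _ => integrable_finsetSum _ fun i _ =>
    h.integrable_indicator T T₁ b k i

theorem integral_pulls (k : Fin 2) : ∫ x, (pulls T T₁ b x k T : ℝ) ∂(tableLaw ν)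
    = ∑ i ∈ Finset.range T, (tableLaw ν).real {x : Rewards | i < pulls T T₁ b x k T} := by
  have : ∀ x, (pulls T T₁ b x k T : ℝ) = ∑ i ∈ Finset.range T,
      {x : Rewards | i < pulls T T₁ b x k T}.indicator (fun _ => (1 : ℝ)) x := by
    intro x
    simp only [Set.indicator_apply, Finset.sum_boole, Nat.cast_inj]
    have h1 : (Finset.range T).filter (fun i => x ∈ {x : Rewards | i < pulls T T₁ b x k T})
        = Finset.range (pulls T T₁ b x k T) := by
      ext i
      have := pulls_le T T₁ b x k T
      simp
      omega
    rw [h1, Finset.card_range]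
  simp_rw [this]
  rw [integral_finsetSum]
  · refine Finset.sum_congr rfl fun i _ => ?_
    rw [integral_indicator_const _ (measurableSet_lt_pulls T T₁ b k i), smul_eq_mul, mul_one]
  · exact fun i _ => (integrable_const _).indicator (measurableSet_lt_pulls T T₁ b k i)

/-- Wald's identity for the rewards collected by the algorithm. -/
theorem IsSubgaussian.integral_totalReward (h : IsSubgaussian ν) :
    ∫ x, totalReward T T₁ b x ∂(tableLaw ν)
      = ∑ k, mean ν k * ∫ x, (pulls T T₁ b x k T : ℝ) ∂(tableLaw ν) := by
  simp_rw [totalReward_eq_sum_indicator]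
  rw [integral_finsetSum _ fun k _ => integrable_finsetSum _ fun i _ =>
    h.integrable_indicator T T₁ b k i]
  refine Finset.sum_congr rfl fun k _ => ?_
  rw [integral_finsetSum _ fun i _ => h.integrable_indicator T T₁ b k i, integral_pulls,
    Finset.mul_sum]
  exact Finset.sum_congr rfl fun i _ => integral_mul_indicator_of_dependsOn ν
    (measurableSet_lt_pulls T T₁ b k i) (k, i) (dependsOn_lt_pulls T T₁ b (k, i) T)

theorem IsSubgaussian.regret_eq (h : IsSubgaussian ν) {k : Fin 2}
    (hk : mean ν (other k) = mean ν k + gap ν) :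
    regret ν T T₁ b = gap ν * ∫ x, (pulls T T₁ b x k T : ℝ) ∂(tableLaw ν) := by
  have hgap : 0 ≤ gap ν := abs_nonneg _
  have hint : ∀ k, Integrable (fun x => (pulls T T₁ b x k T : ℝ)) (tableLaw ν) := fun k =>
    integrable_natCast (measurable_pulls T T₁ b k T) fun x => pulls_le T T₁ b x k T
  have h1 : ∫ x, (pulls T T₁ b x (other k) T : ℝ) ∂(tableLaw ν)
      = T - ∫ x, (pulls T T₁ b x k T : ℝ) ∂(tableLaw ν) := by
    rw [eq_sub_iff_add_eq, ← integral_add (hint _) (hint _)]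
    have : ∀ x, (pulls T T₁ b x (other k) T : ℝ) + pulls T T₁ b x k T = T := fun x => by
      rw [add_comm]
      exact_mod_cast pulls_add_pulls_other T T₁ b x k T
    simp [this]
  have h2 : max (mean ν 0) (mean ν 1) = mean ν (other k) := by
    fin_cases k
    · have : mean ν 1 = mean ν 0 + gap ν := by simpa [other] using hk
      simp [other]; linarith
    · have : mean ν 0 = mean ν 1 + gap ν := by simpa [other] using hk
      simp [other]; linarith
  have h3 : ∫ x, totalReward T T₁ b x ∂(tableLaw ν)
      = mean ν k * ∫ x, (pulls T T₁ b x k T : ℝ) ∂(tableLaw ν)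
        + mean ν (other k) * ∫ x, (pulls T T₁ b x (other k) T : ℝ) ∂(tableLaw ν) := by
    rw [h.integral_totalReward, Fin.sum_univ_two]
    fin_cases k
    · simp [other]
    · simp [other]; ring
  rw [regret, h2, h3, h1, hk]
  ring

theorem exists_inferior (ν : Fin 2 → Measure ℝ) :
    ∃ k, mean ν (other k) = mean ν k + gap ν := by
  rcases le_total (mean ν 0) (mean ν 1) with h | h
  · exact ⟨0, by rw [gap, abs_of_nonpos (by linarith)]; simp [other]⟩
  · exact ⟨1, by rw [gap, abs_of_nonneg (by linarith)]; simp [other]⟩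

end Regret

/-! ### Deterministic bounds for the lengths of the stages -/

open Classical in
theorem τ₁_le {T₁ : ℝ} (x : Rewards) {s : ℕ} (hs : 1 ≤ s) (h0 : 0 ≤ T₁) (h : T₁ ≤ 2 * s) :
    τ₁ T₁ x ≤ s := by
  refine Nat.find_min' _ ⟨hs, ?_⟩
  have h1 : Real.posLog (T₁ / (2 * s : ℝ)) = 0 := by
    rw [Real.posLog_eq_zero_iff, abs_of_nonneg (by positivity)]
    exact div_le_one_of_le₀ h (by positivity)
  rw [h1, mul_zero, Real.sqrt_zero, not_lt]
  exact abs_nonneg _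

theorem τ₁_le_floor {T₁ : ℝ} (h0 : 0 ≤ T₁) (x : Rewards) : τ₁ T₁ x ≤ ⌊T₁⌋₊ + 1 := by
  refine τ₁_le x (by omega) h0 ?_
  have := Nat.lt_floor_add_one T₁
  push_cast
  linarith

theorem pulls₂_eq {T₁ : ℝ} (h0 : 0 ≤ T₁) (x : Rewards) : pulls₂ T₁ x = ⌊T₁⌋₊ + 1 :=
  max_eq_right (τ₁_le_floor h0 x)

open Classical in
theorem t₂_le (T : ℕ) (T₁ : ℝ) (b : Fin 2) (x : Rewards) :
    t₂ T T₁ b x ≤ ⌊Real.log T ^ 2⌋₊ + 1 := by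
  refine Nat.find_min' _ ⟨by omega, fun h => ?_⟩
  have h1 := Nat.lt_floor_add_one (Real.log T ^ 2)
  have h2 := h.2
  push_cast at h2
  linarith

/-! ### Two exponential sums -/

theorem sum_Ico_exp_neg_mul_le {c : ℝ} (hc : 0 < c) {m : ℕ} (hm : 1 ≤ m) (n : ℕ) :
    ∑ s ∈ Finset.Ico m n, Real.exp (-(s * c)) ≤ 1 / c := by
  have h : ∀ n : ℕ, c * ∑ s ∈ Finset.range n, Real.exp (-((s + 1 : ℕ) * c))
      ≤ 1 - Real.exp (-(n * c)) := by
    intro n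
    induction n with
    | zero => simp
    | succ n ih =>
      rw [Finset.sum_range_succ, mul_add]
      -- `c * exp (-c) ≤ 1 - exp (-c)`, so that the sum telescopes.
      have h1 : c * Real.exp (-((n + 1 : ℕ) * c))
          ≤ Real.exp (-(n * c)) - Real.exp (-((n + 1 : ℕ) * c)) := by
        have h2 : Real.exp (-(n * c)) = Real.exp c * Real.exp (-((n + 1 : ℕ) * c)) := by
          rw [← Real.exp_add]; congr 1; push_cast; ring
        rw [h2]
        nlinarith [Real.add_one_le_exp c, Real.exp_pos (-((n + 1 : ℕ) * c))]
      linarith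
  have h1 : ∑ s ∈ Finset.Ico m n, Real.exp (-(s * c))
      ≤ ∑ s ∈ Finset.range n, Real.exp (-((s + 1 : ℕ) * c)) := by
    rw [Finset.sum_Ico_eq_sum_range]
    calc ∑ i ∈ Finset.range (n - m), Real.exp (-((m + i : ℕ) * c))
        ≤ ∑ i ∈ Finset.range (n - m), Real.exp (-((i + 1 : ℕ) * c)) := by
          refine Finset.sum_le_sum fun i _ => Real.exp_le_exp.2 (neg_le_neg ?_)
          have : ((i + 1 : ℕ) : ℝ) ≤ (m + i : ℕ) := by exact_mod_cast (by omega)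
          exact mul_le_mul_of_nonneg_right this hc.le
      _ ≤ _ := Finset.sum_le_sum_of_subset_of_nonneg (by
          intro i; simp; omega) fun _ _ _ => (Real.exp_pos _).le
  rw [le_div_iff₀ hc, mul_comm]
  have := Real.exp_pos (-(n * c))
  nlinarith [h n]

theorem sum_two_pow_mul_exp_le {c : ℝ} (hc : 0 < c) (n : ℕ) :
    ∑ j ∈ Finset.range n, (2 : ℝ) ^ j * Real.exp (-(2 ^ j * c)) ≤ 2 / c := by
  have h : ∀ n : ℕ, ∑ j ∈ Finset.range n, c * ((2 : ℝ) ^ j * Real.exp (-(2 ^ j * c)))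
      ≤ 2 * (1 - Real.exp (-(2 ^ n * c / 2))) := by
    intro n
    induction n with
    | zero =>
      simp only [Finset.range_zero, Finset.sum_empty]
      have : Real.exp (-(2 ^ 0 * c / 2)) ≤ 1 := Real.exp_le_one_iff.2 (by simp; positivity)
      linarith
    | succ n ih =>
      rw [Finset.sum_range_succ]
      -- With `u = 2 ^ n * c / 2` this is `2 u exp (-2 u) ≤ 2 (exp (-u) - exp (-2 u))`.
      have h1 : c * ((2 : ℝ) ^ n * Real.exp (-(2 ^ n * c)))
          ≤ 2 * (Real.exp (-(2 ^ n * c / 2)) - Real.exp (-(2 ^ (n + 1) * c / 2))) := by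
        have h2 : Real.exp (-(2 ^ n * c / 2))
            = Real.exp (2 ^ n * c / 2) * Real.exp (-(2 ^ n * c)) := by
          rw [← Real.exp_add]; congr 1; ring
        have h3 : (2 : ℝ) ^ (n + 1) * c / 2 = 2 ^ n * c := by ring
        rw [h2, h3]
        nlinarith [Real.add_one_le_exp (2 ^ n * c / 2), Real.exp_pos (-(2 ^ n * c))]
      linarith
  rw [le_div_iff₀ hc, mul_comm, Finset.mul_sum]
  have := Real.exp_pos (-(2 ^ n * c / 2))
  linarith [h n]

theorem exp_neg_posLog_le {u : ℝ} (hu : 0 < u) : Real.exp (-Real.posLog u) ≤ 1 / u := by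
  rw [one_div, ← Real.exp_log (inv_pos.2 hu), Real.log_inv]
  exact Real.exp_le_exp.2 (neg_le_neg (le_max_right _ _))

/-! ### Expectations of stopping times from tail bounds -/

theorem integral_natCast_le {P : Measure Rewards} [IsProbabilityMeasure P] {f : Rewards → ℕ}
    (hf : Measurable f) {M : ℕ} (hM : ∀ x, f x ≤ M) (m : ℕ) :
    ∫ x, (f x : ℝ) ∂P ≤ m + ∑ s ∈ Finset.Ico m M, P.real {x | s < f x} := by
  have hms : ∀ s, MeasurableSet {x | s < f x} := fun s => measurableSet_lt measurable_const hf
  have hint : ∀ s ∈ Finset.Ico m M,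
      Integrable ({x | s < f x}.indicator fun _ => (1 : ℝ)) P :=
    fun s _ => (integrable_const _).indicator (hms s)
  have h1 : ∀ x, (f x : ℝ) ≤ m + ∑ s ∈ Finset.Ico m M, {x | s < f x}.indicator (fun _ => 1) x := by
    intro x
    have h2 : ∑ s ∈ Finset.Ico m M, {x | s < f x}.indicator (fun _ => (1 : ℝ)) x
        = ((Finset.Ico m (f x)).card : ℝ) := by
      simp only [Set.indicator_apply, Finset.sum_boole, Nat.cast_inj]
      congr 1
      ext s
      have := hM x
      simp
      omega
    rw [h2, Nat.card_Ico]
    have : f x ≤ m + (f x - m) := by omega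
    exact_mod_cast this
  calc ∫ x, (f x : ℝ) ∂P
      ≤ ∫ x, (m + ∑ s ∈ Finset.Ico m M, {x | s < f x}.indicator (fun _ => (1 : ℝ)) x) ∂P :=
        integral_mono (integrable_natCast hf hM)
          ((integrable_const _).add (integrable_finsetSum _ hint)) h1
    _ = _ := by
        rw [integral_add (integrable_const _) (integrable_finsetSum _ hint),
          integral_finsetSum _ hint]
        simp [integral_indicator_const _ (hms _)]

/-! ### Uniform exploration -/

section Exploration

variable {ν : Fin 2 → Measure ℝ} [∀ k, IsProbabilityMeasure (ν k)]

theorem abs_mean_sub_other (ν : Fin 2 → Measure ℝ) (k : Fin 2) :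
    |mean ν k - mean ν (other k)| = gap ν := by
  fin_cases k
  · simp [other, gap]
  · simp only [other, gap]; exact abs_sub_comm _ _

theorem abs_avg_sub_eq (x : Rewards) (k : Fin 2) (s : ℕ) :
    |avg x 0 0 s - avg x 1 0 s| = |avg x k 0 s - avg x (other k) 0 s| := by
  fin_cases k
  · simp [other]
  · simp only [other]; exact abs_sub_comm _ _

theorem le_of_argmax_eq {b : Fin 2} {u : Fin 2 → ℝ} {k : Fin 2} (h : argmax b (u 0) (u 1) = k) :
    u (other k) ≤ u k := by
  unfold argmax at h
  subst h
  split_ifs with h1 h2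
  · simpa [other] using h1.le
  · simpa [other] using h2.le
  · have h3 : u 0 = u 1 := le_antisymm (not_lt.1 h1) (not_lt.1 h2)
    have : b = 0 ∨ b = 1 := by omega
    rcases this with rfl | rfl <;> simp [other, h3]

open Classical in
theorem stop₁_τ₁ (T₁ : ℝ) (x : Rewards) : Stop₁ T₁ x (τ₁ T₁ x) :=
  Nat.find_spec (exists_stop₁ T₁ x)

open Classical in
theorem not_stop₁_of_lt {T₁ : ℝ} {x : Rewards} {s : ℕ} (h : s < τ₁ T₁ x) : ¬ Stop₁ T₁ x s :=
  Nat.find_min (exists_stop₁ T₁ x) h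

/-- The exploration ends with the inferior arm in the lead with probability `O(1 / (T₁ Δ²))`: the
maximal inequality is used on each dyadic block `2 ^ j ≤ s < 2 ^ (j + 1)` of numbers of pulls, where
the threshold contributes a factor of order `2 ^ j / T₁` and the drift a factor
`exp (- 2 ^ j Δ² / 8)`. -/
theorem IsSubgaussian.measureReal_lead_le (h : IsSubgaussian ν) {k : Fin 2}
    (hk : mean ν (other k) = mean ν k + gap ν) (hgap : 0 < gap ν) {T₁ : ℝ} (hT : 0 < T₁)
    (b : Fin 2) :
    (tableLaw ν).real {x | lead T₁ b x = k} ≤ 64 / (T₁ * gap ν ^ 2) := by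
  set D := gap ν with hD
  let a : ℕ → ℝ := fun j => 2 ^ j * D + √(8 * 2 ^ j * Real.posLog (T₁ / (4 * 2 ^ j)))
  have hsub : {x | lead T₁ b x = k} ⊆ ⋃ j ∈ Finset.range (⌊T₁⌋₊ + 1),
      {x | ∃ s, 1 ≤ s ∧ s ≤ 2 ^ (j + 1) ∧ a j ≤
        s * ((avg x k 0 s - avg x (other k) 0 s) - (mean ν k - mean ν (other k)))} := by
    intro x hx
    set s := τ₁ T₁ x with hs
    have hs1 : 1 ≤ s := one_le_τ₁ T₁ x
    have hs2 : s ≤ ⌊T₁⌋₊ + 1 := τ₁_le_floor hT.le x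
    have hlow : 2 ^ Nat.log 2 s ≤ s := Nat.pow_log_le_self 2 (by omega)
    have hup : s < 2 ^ (Nat.log 2 s + 1) := Nat.lt_pow_succ_log_self (by norm_num) s
    have hlt : Nat.log 2 s < ⌊T₁⌋₊ + 1 := (Nat.lt_two_pow_self).trans_le (hlow.trans hs2)
    simp only [Set.mem_iUnion]
    refine ⟨Nat.log 2 s, Finset.mem_range.2 hlt, s, hs1, hup.le, ?_⟩
    set j := Nat.log 2 s
    have hlow' : (2 : ℝ) ^ j ≤ s := by exact_mod_cast hlow
    have hup' : (s : ℝ) ≤ 2 * 2 ^ j := by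
      have : s ≤ 2 * 2 ^ j := by rw [pow_succ] at hup; omega
      exact_mod_cast this
    have hspos : (0 : ℝ) < s := by positivity
    have hthr := not_lt.1 (stop₁_τ₁ T₁ x).2
    have hle : avg x (other k) 0 s ≤ avg x k 0 s :=
      le_of_argmax_eq (u := fun k => avg x k 0 s) hx
    rw [abs_avg_sub_eq x k, abs_of_nonneg (sub_nonneg.2 hle)] at hthr
    have h1 : √(8 * 2 ^ j * Real.posLog (T₁ / (4 * 2 ^ j)))
        ≤ s * √(16 / (2 * s : ℝ) * Real.posLog (T₁ / (2 * s : ℝ))) := by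
      rw [← Real.sqrt_sq hspos.le, ← Real.sqrt_mul (sq_nonneg _), Real.sqrt_sq hspos.le]
      refine Real.sqrt_le_sqrt ?_
      have h2 : (s : ℝ) ^ 2 * (16 / (2 * s : ℝ) * Real.posLog (T₁ / (2 * s : ℝ)))
          = 8 * s * Real.posLog (T₁ / (2 * s : ℝ)) := by
        field_simp; ring
      rw [h2]
      have h3 : Real.posLog (T₁ / (4 * 2 ^ j)) ≤ Real.posLog (T₁ / (2 * s : ℝ)) := by
        refine Real.posLog_le_posLog (by positivity) ?_
        exact div_le_div_of_nonneg_left hT.le (by positivity) (by linarith)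
      have h4 := Real.posLog_nonneg (x := T₁ / (4 * 2 ^ j))
      exact mul_le_mul (by linarith) h3 h4 (by positivity)
    have h5 : (s : ℝ) * √(16 / (2 * s : ℝ) * Real.posLog (T₁ / (2 * s : ℝ)))
        ≤ s * (avg x k 0 s - avg x (other k) 0 s) := mul_le_mul_of_nonneg_left hthr hspos.le
    have h6 : 2 ^ j * D ≤ s * D := mul_le_mul_of_nonneg_right hlow' hgap.le
    have h7 : mean ν k - mean ν (other k) = -D := by rw [hk]; ring
    rw [h7]
    simp only [a]
    linarith
  have hbound : ∀ j, (tableLaw ν).real {x | ∃ s, 1 ≤ s ∧ s ≤ 2 ^ (j + 1) ∧ a j ≤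
        s * ((avg x k 0 s - avg x (other k) 0 s) - (mean ν k - mean ν (other k)))}
      ≤ 4 / T₁ * (2 ^ j * Real.exp (-(2 ^ j * (D ^ 2 / 8)))) := by
    intro j
    have hpos : (0 : ℝ) < 2 ^ j := by positivity
    have ha0 : 0 ≤ a j := by positivity
    refine (h.measureReal_exists_diff_ge (other_ne k) Nat.one_le_two_pow ha0).trans ?_
    set l := Real.posLog (T₁ / (4 * 2 ^ j)) with hl
    have hl0 : 0 ≤ l := Real.posLog_nonneg
    have h1 : (2 ^ j * D) ^ 2 + 8 * 2 ^ j * l ≤ a j ^ 2 := by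
      have h2 := Real.sq_sqrt (show 0 ≤ 8 * 2 ^ j * l by positivity)
      have h3 : 0 ≤ √(8 * 2 ^ j * l) := Real.sqrt_nonneg _
      have h4 : 0 ≤ 2 ^ j * D := by positivity
      simp only [a, ← hl]
      nlinarith
    have h2 : 2 ^ j * (D ^ 2 / 8) + l ≤ a j ^ 2 / (4 * (2 ^ (j + 1) : ℕ)) := by
      rw [le_div_iff₀ (by positivity)]
      push_cast
      rw [pow_succ (2 : ℝ) j]
      nlinarith
    calc Real.exp (-(a j ^ 2 / (4 * (2 ^ (j + 1) : ℕ))))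
        ≤ Real.exp (-(2 ^ j * (D ^ 2 / 8)) + -l) := Real.exp_le_exp.2 (by linarith)
      _ = Real.exp (-(2 ^ j * (D ^ 2 / 8))) * Real.exp (-l) := Real.exp_add _ _
      _ ≤ Real.exp (-(2 ^ j * (D ^ 2 / 8))) * (1 / (T₁ / (4 * 2 ^ j))) :=
          mul_le_mul_of_nonneg_left (exp_neg_posLog_le (by positivity)) (Real.exp_pos _).le
      _ = _ := by field_simp
  calc (tableLaw ν).real {x | lead T₁ b x = k}
      ≤ ∑ j ∈ Finset.range (⌊T₁⌋₊ + 1), 4 / T₁ * (2 ^ j * Real.exp (-(2 ^ j * (D ^ 2 / 8)))) :=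
        (measureReal_mono hsub (measure_ne_top _ _)).trans ((measureReal_biUnion_finset_le _ _).trans
          (Finset.sum_le_sum fun j _ => hbound j))
    _ ≤ 4 / T₁ * (2 / (D ^ 2 / 8)) := by
        rw [← Finset.mul_sum]
        exact mul_le_mul_of_nonneg_left (sum_two_pow_mul_exp_le (by positivity) _) (by positivity)
    _ = 64 / (T₁ * D ^ 2) := by field_simp; norm_num

/-- The exploration lasts `O((1 + log⁺ (T₁ Δ²)) / Δ²)` rounds in expectation, since the threshold
is at most `Δ / 2` from then on. -/
theorem IsSubgaussian.integral_τ₁_le (h : IsSubgaussian ν) (hgap : 0 < gap ν) {T₁ : ℝ}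
    (hT : 0 < T₁) :
    ∫ x, (τ₁ T₁ x : ℝ) ∂(tableLaw ν)
      ≤ 1 + (48 + 32 * Real.posLog (T₁ * gap ν ^ 2)) / gap ν ^ 2 := by
  obtain ⟨k, hk⟩ := exists_inferior ν
  set D := gap ν with hD
  set l := Real.posLog (T₁ * D ^ 2) with hl
  have hl0 : 0 ≤ l := Real.posLog_nonneg
  set A : ℝ := 32 * (1 + l) / D ^ 2 with hA
  have hA0 : 0 < A := by positivity
  have hm1 : 1 ≤ ⌈A⌉₊ := Nat.one_le_iff_ne_zero.2 (Nat.ceil_pos.2 hA0).ne'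
  have hbound : ∀ s ∈ Finset.Ico ⌈A⌉₊ (⌊T₁⌋₊ + 1), (tableLaw ν).real {x | s < τ₁ T₁ x}
      ≤ Real.exp (-(s * (D ^ 2 / 16))) := by
    intro s hs
    have hsA : A ≤ s := Nat.ceil_le.1 (Finset.mem_Ico.1 hs).1
    have hs1 : 1 ≤ s := hm1.trans (Finset.mem_Ico.1 hs).1
    have hspos : (0 : ℝ) < s := by positivity
    have hth : √(16 / (2 * s : ℝ) * Real.posLog (T₁ / (2 * s : ℝ))) ≤ D / 2 := by
      refine Real.sqrt_le_iff.2 ⟨by positivity, ?_⟩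
      have hAs : 32 * (1 + l) ≤ s * D ^ 2 := by
        rw [hA, div_le_iff₀ (by positivity)] at hsA; exact hsA
      have h1 : Real.posLog (T₁ / (2 * s : ℝ)) ≤ l := by
        refine Real.posLog_le_posLog (by positivity) ?_
        rw [div_le_iff₀ (by positivity)]
        have h2 : 1 ≤ D ^ 2 * (2 * s) := by nlinarith
        nlinarith
      have h3 : 16 / (2 * s : ℝ) * Real.posLog (T₁ / (2 * s : ℝ)) ≤ 16 / (2 * s : ℝ) * l :=
        mul_le_mul_of_nonneg_left h1 (by positivity)
      refine h3.trans ?_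
      rw [div_mul_eq_mul_div, div_le_iff₀ (by positivity)]
      nlinarith
    have hsub : {x | s < τ₁ T₁ x} ⊆ {x | ∃ s', 1 ≤ s' ∧ s' ≤ s ∧ s * (D / 2) ≤
        s' * ((avg x k 0 s' - avg x (other k) 0 s') - (mean ν k - mean ν (other k)))} := by
      intro x hx
      refine ⟨s, hs1, le_rfl, mul_le_mul_of_nonneg_left ?_ hspos.le⟩
      have h1 : |avg x 0 0 s - avg x 1 0 s|
          < √(16 / (2 * s : ℝ) * Real.posLog (T₁ / (2 * s : ℝ))) := by
        by_contra hc
        exact not_stop₁_of_lt hx ⟨hs1, hc⟩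
      rw [abs_avg_sub_eq x k] at h1
      have h2 := (abs_lt.1 (h1.trans_le hth)).1
      rw [hk]
      linarith
    refine (measureReal_mono hsub).trans
      ((h.measureReal_exists_diff_ge (other_ne k) hs1 (by positivity)).trans_eq ?_)
    congr 1
    field_simp
    norm_num
  calc ∫ x, (τ₁ T₁ x : ℝ) ∂(tableLaw ν)
      ≤ ⌈A⌉₊ + ∑ s ∈ Finset.Ico ⌈A⌉₊ (⌊T₁⌋₊ + 1), (tableLaw ν).real {x | s < τ₁ T₁ x} :=
        integral_natCast_le (measurable_τ₁ T₁) (τ₁_le_floor hT.le) _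
    _ ≤ (A + 1) + 1 / (D ^ 2 / 16) := by
        refine add_le_add (Nat.ceil_lt_add_one hA0.le).le ((Finset.sum_le_sum hbound).trans ?_)
        exact sum_Ico_exp_neg_mul_le (by positivity) hm1 _
    _ = 1 + (48 + 32 * l) / D ^ 2 := by
        rw [hA]; field_simp; ring

end Exploration

/-! ### The threshold of Stage III -/

/-- The logarithmic factor of the threshold of Stage III. -/
noncomputable def bonus (T n : ℕ) : ℝ :=
  Real.log (Real.exp 1 * T / n * (Real.log (T / n) ^ 2 + 1))

/-- The threshold of Stage III after `n` pulls. -/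
noncomputable def threshold (T n : ℕ) : ℝ := √(2 / (n : ℝ) * bonus T n)

theorem threshold_nonneg (T n : ℕ) : 0 ≤ threshold T n := Real.sqrt_nonneg _

section Bonus

variable {T n : ℕ}

theorem bonus_eq (hn : 1 ≤ n) (hT : n ≤ T) : bonus T n
    = 1 + (Real.log T - Real.log n) + Real.log ((Real.log T - Real.log n) ^ 2 + 1) := by
  have hn0 : (n : ℝ) ≠ 0 := by positivity
  have hT0 : (T : ℝ) ≠ 0 := by
    have : 1 ≤ T := hn.trans hT
    positivity
  have h1 : Real.log (T / n) = Real.log T - Real.log n := Real.log_div hT0 hn0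
  rw [bonus, Real.log_mul (by positivity) (by positivity), h1, mul_div_assoc,
    Real.log_mul (by positivity) (by positivity), Real.log_exp, h1]

theorem log_le_log_of_le (hn : 1 ≤ n) (hT : n ≤ T) :
    0 ≤ Real.log n ∧ Real.log n ≤ Real.log T :=
  ⟨Real.log_natCast_nonneg n, Real.log_le_log (by positivity) (by exact_mod_cast hT)⟩

theorem log_sub_log_le_bonus (hn : 1 ≤ n) (hT : n ≤ T) :
    1 + (Real.log T - Real.log n) ≤ bonus T n := by
  rw [bonus_eq hn hT]
  have := Real.log_nonneg (show 1 ≤ (Real.log T - Real.log n) ^ 2 + 1 by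
    linarith [sq_nonneg (Real.log T - Real.log n)])
  linarith

theorem bonus_nonneg (hn : 1 ≤ n) (hT : n ≤ T) : 0 ≤ bonus T n := by
  have := log_sub_log_le_bonus hn hT
  have := (log_le_log_of_le hn hT).2
  linarith

theorem bonus_le (hn : 1 ≤ n) (hT : n ≤ T) :
    bonus T n ≤ 1 + Real.log T + Real.log (Real.log T ^ 2 + 1) := by
  rw [bonus_eq hn hT]
  obtain ⟨h1, h2⟩ := log_le_log_of_le hn hT
  have h3 : Real.log ((Real.log T - Real.log n) ^ 2 + 1) ≤ Real.log (Real.log T ^ 2 + 1) := by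
    refine Real.log_le_log (by positivity) ?_
    nlinarith
  linarith

theorem log_sq_add_one_le {u : ℝ} (hu : 0 ≤ u) : Real.log (u ^ 2 + 1) ≤ 2 * u := by
  calc Real.log (u ^ 2 + 1) ≤ Real.log ((1 + u) ^ 2) :=
        Real.log_le_log (by positivity) (by nlinarith)
    _ = 2 * Real.log (1 + u) := by rw [Real.log_pow]; norm_num
    _ ≤ 2 * u := by
        have := Real.log_le_sub_one_of_pos (show 0 < 1 + u by linarith)
        linarith

theorem bonus_le_four_mul_log (hn : 1 ≤ n) (hT : n ≤ T) (hlog : 1 ≤ Real.log T) :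
    bonus T n ≤ 4 * Real.log T := by
  have h1 := bonus_le hn hT
  have h2 := log_sq_add_one_le (show 0 ≤ Real.log T by linarith)
  linarith

theorem sq_threshold (hn : 1 ≤ n) (hT : n ≤ T) : n * threshold T n ^ 2 = 2 * bonus T n := by
  have hb := bonus_nonneg hn hT
  have hn0 : (n : ℝ) ≠ 0 := by positivity
  rw [threshold, Real.sq_sqrt (by positivity)]
  field_simp

theorem exp_neg_bonus_le (hn : 1 ≤ n) (hT : n ≤ T) :
    Real.exp (-bonus T n) ≤ n / (T * ((Real.log T - Real.log n) ^ 2 + 1)) := by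
  have hn0 : (0 : ℝ) < n := by positivity
  have hT0 : (0 : ℝ) < T := by
    have : 1 ≤ T := hn.trans hT
    positivity
  rw [bonus_eq hn hT, neg_add, Real.exp_add, Real.exp_neg (Real.log _),
    Real.exp_log (by positivity)]
  have h1 : Real.exp (-(1 + (Real.log T - Real.log n))) ≤ n / T := by
    rw [show -(1 + (Real.log T - Real.log n)) = Real.log n - Real.log T + -1 by ring, Real.exp_add,
      Real.exp_sub, Real.exp_log hn0, Real.exp_log hT0]
    exact mul_le_of_le_one_right (by positivity) (Real.exp_le_one_iff.2 (by norm_num))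
  calc _ ≤ (n / T : ℝ) * ((Real.log T - Real.log n) ^ 2 + 1)⁻¹ :=
        mul_le_mul_of_nonneg_right h1 (by positivity)
    _ = _ := by rw [div_mul_eq_div_div]; rfl

end Bonus

/-! ### Stage III -/

section StageThree

variable {ν : Fin 2 → Measure ℝ} [∀ k, IsProbabilityMeasure (ν k)]

theorem IsSubgaussian.measureReal_leadMean_le (h : IsSubgaussian ν) {T₁ : ℝ} (hT : 0 ≤ T₁)
    (b : Fin 2) {r : ℝ} (hr : 0 ≤ r) :
    (tableLaw ν).real {x | r ≤ |leadMean T₁ b x - mean ν (lead T₁ b x)|}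
      ≤ 4 * Real.exp (-(T₁ * r ^ 2 / 2)) := by
  have hsub : {x | r ≤ |leadMean T₁ b x - mean ν (lead T₁ b x)|} ⊆
      {x | r ≤ |avg x 0 0 (⌊T₁⌋₊ + 1) - mean ν 0|}
        ∪ {x | r ≤ |avg x 1 0 (⌊T₁⌋₊ + 1) - mean ν 1|} := by
    intro x hx
    have hx' : r ≤ |leadMean T₁ b x - mean ν (lead T₁ b x)| := hx
    rw [leadMean, pulls₂_eq hT] at hx'
    rcases eq_or_eq_other (lead T₁ b x) 0 with h0 | h0 <;> rw [h0] at hx'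
    · exact Or.inl hx'
    · exact Or.inr hx'
  have hexp : Real.exp (-((⌊T₁⌋₊ + 1 : ℕ) * r ^ 2 / 2)) ≤ Real.exp (-(T₁ * r ^ 2 / 2)) := by
    refine Real.exp_le_exp.2 ?_
    have := Nat.lt_floor_add_one T₁
    push_cast
    nlinarith [sq_nonneg r]
  have h0 := h.measureReal_abs_avg_ge 0 (n := ⌊T₁⌋₊ + 1) (by omega) hr
  have h1 := h.measureReal_abs_avg_ge 1 (n := ⌊T₁⌋₊ + 1) (by omega) hr
  refine (measureReal_mono hsub).trans ((measureReal_union_le _ _).trans ?_)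
  linarith

/-- The rewards of Stage III are fresh, so Hoeffding's bound holds for their averages. -/
theorem IsSubgaussian.measureReal_θ_le (h : IsSubgaussian ν) (T₁ : ℝ) (b : Fin 2) {n : ℕ}
    (hn : 1 ≤ n) {r : ℝ} (hr : 0 ≤ r) :
    (tableLaw ν).real {x | r ≤ |θ T₁ b x n - mean ν (rest T₁ b x)|}
      ≤ 4 * Real.exp (-(n * r ^ 2 / 2)) := by
  let B : Fin 2 → Set Rewards := fun k => {y | r ≤ |avg y k 0 n - mean ν k|}
  have hB : ∀ k, MeasurableSet (B k) := fun k =>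
    measurableSet_le measurable_const ((measurable_avg k 0 n).sub_const _).abs
  have hsub : {x | r ≤ |θ T₁ b x n - mean ν (rest T₁ b x)|} ⊆
      {x | shift (fun _ => τ₁ T₁ x) x ∈ B 0} ∪ {x | shift (fun _ => τ₁ T₁ x) x ∈ B 1} := by
    intro x hx
    have hx' : r ≤ |θ T₁ b x n - mean ν (rest T₁ b x)| := hx
    rw [θ_eq] at hx'
    rcases eq_or_eq_other (rest T₁ b x) 0 with h0 | h0 <;> rw [h0] at hx'
    · exact Or.inl hx'
    · exact Or.inr hx'
  have h0 := h.measureReal_abs_avg_ge 0 hn hr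
  have h1 := h.measureReal_abs_avg_ge 1 hn hr
  refine (measureReal_mono hsub).trans ((measureReal_union_le _ _).trans ?_)
  rw [measureReal_shift ν (isStoppingRule_τ₁ T₁) (hB 0),
    measureReal_shift ν (isStoppingRule_τ₁ T₁) (hB 1)]
  linarith

open Classical in
theorem stop₃_t₂ (T : ℕ) (T₁ : ℝ) (b : Fin 2) (x : Rewards) : Stop₃ T T₁ b x (t₂ T T₁ b x) :=
  Nat.find_spec (exists_stop₃ T T₁ b x)

open Classical in
theorem not_stop₃_of_lt {T : ℕ} {T₁ : ℝ} {b : Fin 2} {x : Rewards} {n : ℕ}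
    (h : n < t₂ T T₁ b x) : ¬ Stop₃ T T₁ b x n :=
  Nat.find_min (exists_stop₃ T T₁ b x) h

theorem abs_lt_threshold_of_lt_t₂ {T : ℕ} {T₁ : ℝ} {b : Fin 2} {x : Rewards} {n : ℕ} (hn : 1 ≤ n)
    (h : n < t₂ T T₁ b x) :
    |leadMean T₁ b x - θ T₁ b x n| < threshold T n ∧ (n : ℝ) < Real.log T ^ 2 := by
  by_contra hc
  exact not_stop₃_of_lt h ⟨hn, hc⟩

theorem threshold_le_abs_of_t₂_lt {T : ℕ} {T₁ : ℝ} {b : Fin 2} {x : Rewards}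
    (h : (t₂ T T₁ b x : ℝ) < Real.log T ^ 2) :
    threshold T (t₂ T T₁ b x) ≤ |leadMean T₁ b x - θ T₁ b x (t₂ T T₁ b x)| := by
  by_contra hc
  exact (stop₃_t₂ T T₁ b x).2 ⟨not_le.1 hc, h⟩

/-- Stage III lasts at most `m` steps, up to the contribution of deviations of size `r`, if its
threshold is at most `Δ - 2 r` from then on. -/
theorem IsSubgaussian.integral_t₂_le (h : IsSubgaussian ν) (T : ℕ) {T₁ : ℝ} (hT : 0 ≤ T₁)
    (b : Fin 2) {r : ℝ} (hr : 0 < r) {m : ℕ} (hm : 1 ≤ m)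
    (hth : ∀ n : ℕ, m ≤ n → (n : ℝ) < Real.log T ^ 2 → threshold T n ≤ gap ν - 2 * r) :
    ∫ x, (t₂ T T₁ b x : ℝ) ∂(tableLaw ν)
      ≤ m + Real.log T ^ 2 * (4 * Real.exp (-(T₁ * r ^ 2 / 2))) + 8 / r ^ 2 := by
  have hbound : ∀ n ∈ Finset.Ico m (⌊Real.log T ^ 2⌋₊ + 1),
      (tableLaw ν).real {x | n < t₂ T T₁ b x}
        ≤ 4 * Real.exp (-(T₁ * r ^ 2 / 2)) + 4 * Real.exp (-(n * (r ^ 2 / 2))) := by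
    intro n hn
    have hmn := (Finset.mem_Ico.1 hn).1
    have hn1 : 1 ≤ n := hm.trans hmn
    have hsub : {x | n < t₂ T T₁ b x} ⊆ {x | r ≤ |leadMean T₁ b x - mean ν (lead T₁ b x)|}
        ∪ {x | r ≤ |θ T₁ b x n - mean ν (rest T₁ b x)|} := by
      intro x hx
      obtain ⟨h1, h2⟩ := abs_lt_threshold_of_lt_t₂ hn1 hx
      have h3 := hth n hmn h2
      by_contra hc
      rw [Set.mem_union, not_or] at hc
      have hc1 : |leadMean T₁ b x - mean ν (lead T₁ b x)| < r := not_le.1 hc.1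
      have hc2 : |θ T₁ b x n - mean ν (rest T₁ b x)| < r := not_le.1 hc.2
      have h4 : |mean ν (lead T₁ b x) - mean ν (rest T₁ b x)| = gap ν := abs_mean_sub_other ν _
      rw [abs_lt] at h1 hc1 hc2
      rcases abs_cases (mean ν (lead T₁ b x) - mean ν (rest T₁ b x)) with h5 | h5 <;> linarith
    refine (measureReal_mono hsub).trans ((measureReal_union_le _ _).trans (add_le_add
      (h.measureReal_leadMean_le hT b hr.le) ((h.measureReal_θ_le T₁ b hn1 hr.le).trans_eq ?_)))
    rw [mul_div_assoc]
  refine (integral_natCast_le (measurable_t₂ T T₁ b) (t₂_le T T₁ b) m).trans ?_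
  rw [add_assoc]
  refine add_le_add le_rfl ((Finset.sum_le_sum hbound).trans ?_)
  rw [Finset.sum_add_distrib, Finset.sum_const, Nat.card_Ico, nsmul_eq_mul, ← Finset.mul_sum]
  have h1 : ((⌊Real.log T ^ 2⌋₊ + 1 - m : ℕ) : ℝ) ≤ Real.log T ^ 2 := by
    refine le_trans ?_ (Nat.floor_le (sq_nonneg (Real.log T)))
    exact_mod_cast (by omega)
  have h2 := sum_Ico_exp_neg_mul_le (c := r ^ 2 / 2) (by positivity) hm (⌊Real.log T ^ 2⌋₊ + 1)
  refine add_le_add (mul_le_mul_of_nonneg_right h1 (by positivity)) ?_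
  calc 4 * ∑ i ∈ Finset.Ico m (⌊Real.log T ^ 2⌋₊ + 1), Real.exp (-(i * (r ^ 2 / 2)))
      ≤ 4 * (1 / (r ^ 2 / 2)) := by linarith
    _ = 8 / r ^ 2 := by field_simp; norm_num

/-- Union bound for the commitment to the inferior arm after Stage III: it needs a deviation of the
average `θ` by the threshold plus the gap. -/
theorem IsSubgaussian.measureReal_commit_le (h : IsSubgaussian ν) {k : Fin 2}
    (hk : mean ν (other k) = mean ν k + gap ν) (T : ℕ) {T₁ : ℝ} (hT : 0 ≤ T₁)
    (b : Fin 2) {r : ℝ} (hr : 0 ≤ r)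
    (hth : ∀ n : ℕ, 1 ≤ n → (n : ℝ) < Real.log T ^ 2 → r ≤ threshold T n + gap ν) :
    (tableLaw ν).real {x | (t₂ T T₁ b x : ℝ) < Real.log T ^ 2 ∧ commit T T₁ b x = k}
      ≤ 4 * Real.exp (-(T₁ * r ^ 2 / 2)) + ∑ n ∈ Finset.Ico 1 ⌈Real.log T ^ 2⌉₊,
        4 * Real.exp (-(n * (threshold T n + gap ν - r) ^ 2 / 2)) := by
  have hsub : {x | (t₂ T T₁ b x : ℝ) < Real.log T ^ 2 ∧ commit T T₁ b x = k}
      ⊆ {x | r ≤ |leadMean T₁ b x - mean ν (lead T₁ b x)|} ∪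
        ⋃ n ∈ Finset.Ico 1 ⌈Real.log T ^ 2⌉₊,
          {x | threshold T n + gap ν - r ≤ |θ T₁ b x n - mean ν (rest T₁ b x)|} := by
    rintro x ⟨h1, h2⟩
    by_cases hc : r ≤ |leadMean T₁ b x - mean ν (lead T₁ b x)|
    · exact Or.inl hc
    right
    have hc' := abs_lt.1 (not_le.1 hc)
    simp only [Set.mem_iUnion]
    refine ⟨t₂ T T₁ b x, Finset.mem_Ico.2 ⟨(stop₃_t₂ T T₁ b x).1, Nat.lt_ceil.2 h1⟩, ?_⟩
    change _ ≤ |θ T₁ b x (t₂ T T₁ b x) - mean ν (rest T₁ b x)|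
    have h3 := threshold_le_abs_of_t₂_lt h1
    set n := t₂ T T₁ b x
    unfold commit at h2
    by_cases h4 : θ T₁ b x n ≤ leadMean T₁ b x
    · rw [if_pos h4] at h2
      have h5 : rest T₁ b x = other k := by rw [rest, h2]
      rw [abs_of_nonneg (sub_nonneg.2 h4)] at h3
      rw [h2] at hc'
      rw [h5, hk]
      refine le_trans ?_ (neg_le_abs _)
      linarith
    · rw [if_neg h4] at h2
      have h5 : lead T₁ b x = other k := by
        rw [← h2, rest, other_other]
      have h6 := not_le.1 h4
      rw [abs_of_neg (sub_neg.2 h6)] at h3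
      rw [h5, hk] at hc'
      rw [h2]
      refine le_trans ?_ (le_abs_self _)
      linarith
  refine (measureReal_mono hsub (measure_ne_top _ _)).trans ((measureReal_union_le _ _).trans
    (add_le_add (h.measureReal_leadMean_le hT b hr) ((measureReal_biUnion_finset_le _ _).trans
      (Finset.sum_le_sum fun n hn => ?_))))
  obtain ⟨hn1, hn2⟩ := Finset.mem_Ico.1 hn
  exact h.measureReal_θ_le T₁ b hn1 (by linarith [hth n hn1 (Nat.lt_ceil.1 hn2)])

/-- Stage III does not stop within `m` steps unless an average deviates by the excess of the
threshold over the gap. -/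
theorem IsSubgaussian.measureReal_t₂_le_le (h : IsSubgaussian ν) (T : ℕ) {T₁ : ℝ} (hT : 0 ≤ T₁)
    (b : Fin 2) {r : ℝ} (hr : 0 ≤ r) {m : ℕ} (hm : (m : ℝ) < Real.log T ^ 2)
    (hth : ∀ n : ℕ, 1 ≤ n → n ≤ m → gap ν + r ≤ threshold T n) :
    (tableLaw ν).real {x | t₂ T T₁ b x ≤ m}
      ≤ 4 * Real.exp (-(T₁ * r ^ 2 / 2)) + ∑ n ∈ Finset.Icc 1 m,
        4 * Real.exp (-(n * (threshold T n - gap ν - r) ^ 2 / 2)) := by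
  have hsub : {x | t₂ T T₁ b x ≤ m} ⊆ {x | r ≤ |leadMean T₁ b x - mean ν (lead T₁ b x)|} ∪
        ⋃ n ∈ Finset.Icc 1 m,
          {x | threshold T n - gap ν - r ≤ |θ T₁ b x n - mean ν (rest T₁ b x)|} := by
    intro x hx
    by_cases hc : r ≤ |leadMean T₁ b x - mean ν (lead T₁ b x)|
    · exact Or.inl hc
    right
    have hc' := not_le.1 hc
    have hx' : t₂ T T₁ b x ≤ m := hx
    simp only [Set.mem_iUnion]
    refine ⟨t₂ T T₁ b x, Finset.mem_Icc.2 ⟨(stop₃_t₂ T T₁ b x).1, hx'⟩, ?_⟩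
    change _ ≤ |θ T₁ b x (t₂ T T₁ b x) - mean ν (rest T₁ b x)|
    have h3 := threshold_le_abs_of_t₂_lt
      ((show (t₂ T T₁ b x : ℝ) ≤ m by exact_mod_cast hx').trans_lt hm)
    have h4 : |mean ν (lead T₁ b x) - mean ν (rest T₁ b x)| = gap ν := abs_mean_sub_other ν _
    set n := t₂ T T₁ b x
    have h5 : |leadMean T₁ b x - θ T₁ b x n| ≤ |leadMean T₁ b x - mean ν (lead T₁ b x)|
        + |mean ν (lead T₁ b x) - mean ν (rest T₁ b x)|
        + |θ T₁ b x n - mean ν (rest T₁ b x)| := by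
      rw [abs_sub_comm (θ T₁ b x n)]
      refine le_trans (le_of_eq ?_) (abs_add_three _ _ _)
      congr 1
      ring
    linarith
  refine (measureReal_mono hsub (measure_ne_top _ _)).trans ((measureReal_union_le _ _).trans
    (add_le_add (h.measureReal_leadMean_le hT b hr) ((measureReal_biUnion_finset_le _ _).trans
      (Finset.sum_le_sum fun n hn => ?_))))
  obtain ⟨hn1, hn2⟩ := Finset.mem_Icc.1 hn
  exact h.measureReal_θ_le T₁ b hn1 (by linarith [hth n hn1 hn2])

end StageThree

/-! ### Commitment to the inferior arm after Stage III -/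

theorem le_of_lt_log_sq {T n : ℕ} (hn : (n : ℝ) < Real.log T ^ 2) (hlog : 1 ≤ Real.log T)
    (hT : Real.log T ^ 4 ≤ T) : n ≤ T := by
  have h1 : Real.log T ^ 2 ≤ Real.log T ^ 4 := pow_le_pow_right₀ hlog (by norm_num)
  exact_mod_cast (hn.le.trans (h1.trans hT))

theorem two_mul_log_le {T n : ℕ} (hn1 : 1 ≤ n) (hn : (n : ℝ) < Real.log T ^ 2)
    (hT : Real.log T ^ 4 ≤ T) : 2 * Real.log n ≤ Real.log T := by
  have h1 : (n : ℝ) ^ 2 ≤ T := by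
    refine le_trans ?_ hT
    calc (n : ℝ) ^ 2 ≤ (Real.log T ^ 2) ^ 2 := pow_le_pow_left₀ (by positivity) hn.le 2
      _ = _ := by ring
  have h2 := Real.log_le_log (by positivity) h1
  rw [Real.log_pow] at h2
  exact_mod_cast h2

/-- The deviation `1 / log² T` of the leader's average costs only a constant factor. -/
theorem exp_neg_threshold_le {T n : ℕ} (hn1 : 1 ≤ n) (hn : (n : ℝ) < Real.log T ^ 2)
    (hlog : 1 ≤ Real.log T) (hT : Real.log T ^ 4 ≤ T) {D : ℝ} (hD : 0 < D) :
    T * (4 * Real.exp (-(n * (threshold T n + D - 1 / Real.log T ^ 2) ^ 2 / 2)))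
      ≤ 64 * Real.exp 4 / D ^ 2 / Real.log T ^ 2 := by
  set L := Real.log T with hL
  have hnT := le_of_lt_log_sq hn hlog hT
  have hnpos : (0 : ℝ) < n := by positivity
  have hTpos : (0 : ℝ) < T := lt_of_lt_of_le (by positivity) hT
  set r := 1 / L ^ 2 with hr
  set u := threshold T n with hu
  have hu0 : 0 ≤ u := threshold_nonneg T n
  have hsq : n * u ^ 2 = 2 * bonus T n := sq_threshold hn1 hnT
  have hb := bonus_le_four_mul_log hn1 hnT hlog
  have hr0 : 0 < r := by positivity
  have hnr : n * r ≤ 1 := by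
    rw [hr, mul_one_div, div_le_one (by positivity)]; exact hn.le
  have hr1 : r ≤ 1 := by
    rw [hr, div_le_one (by positivity)]; exact one_le_pow₀ hlog
  have hnr2 : n * r ^ 2 ≤ 1 := by nlinarith
  have hnru : n * r * u ≤ 3 := by
    refine abs_le_of_sq_le_sq' ?_ (by norm_num) |>.2
    have h2 : r * L ≤ 1 := by
      rw [hr, one_div, inv_mul_le_iff₀ (by positivity)]
      nlinarith
    have h3 : r * (n * u ^ 2) ≤ 8 := by rw [hsq]; nlinarith
    calc (n * r * u) ^ 2 = (n * r) * (r * (n * u ^ 2)) := by ring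
      _ ≤ 1 * 8 := mul_le_mul hnr h3 (by positivity) (by norm_num)
      _ ≤ 3 ^ 2 := by norm_num
  -- Expand the square: all terms with `r` are bounded, except `n * r * D`, which is absorbed by half
  -- of `n * D ^ 2 / 2`.
  have hexp : bonus T n + n * D ^ 2 / 4 - 4 ≤ n * (u + D - r) ^ 2 / 2 := by
    have h1 : n * (u + D - r) ^ 2 / 2 = n * u ^ 2 / 2 + n * D ^ 2 / 4 + n * (D / 2 - r) ^ 2
        - n * r ^ 2 / 2 + n * u * D - n * r * u := by ring
    have h2 : 0 ≤ n * (D / 2 - r) ^ 2 := by positivity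
    have h3 : 0 ≤ n * u * D := by positivity
    rw [h1]
    linarith
  have hlogn := two_mul_log_le hn1 hn hT
  -- Since `n ≤ √T`, the factor `log² (T / n) + 1` is at least `log² T / 4`.
  have hE : Real.exp (-bonus T n) ≤ 4 * n / (T * L ^ 2) := by
    refine (exp_neg_bonus_le hn1 hnT).trans ?_
    rw [div_le_div_iff₀ (by positivity) (by positivity)]
    have h1 : L ^ 2 ≤ 4 * ((L - Real.log n) ^ 2 + 1) := by nlinarith
    have h2 := mul_le_mul_of_nonneg_left h1 (show (0 : ℝ) ≤ n * T by positivity)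
    linarith
  have hG : n * Real.exp (-(n * D ^ 2 / 4)) ≤ 4 / D ^ 2 := by
    rw [Real.exp_neg, ← div_eq_mul_inv, div_le_div_iff₀ (Real.exp_pos _) (by positivity)]
    linarith [Real.add_one_le_exp (n * D ^ 2 / 4 : ℝ)]
  have hmain : Real.exp (-(n * (u + D - r) ^ 2 / 2))
      ≤ Real.exp (-bonus T n) * (Real.exp (-(n * D ^ 2 / 4)) * Real.exp 4) := by
    rw [← Real.exp_add, ← Real.exp_add]
    exact Real.exp_le_exp.2 (by linarith)
  calc T * (4 * Real.exp (-(n * (u + D - r) ^ 2 / 2)))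
      ≤ T * (4 * (4 * n / (T * L ^ 2) * (Real.exp (-(n * D ^ 2 / 4)) * Real.exp 4))) := by
        refine mul_le_mul_of_nonneg_left (mul_le_mul_of_nonneg_left (hmain.trans ?_)
          (by norm_num)) hTpos.le
        exact mul_le_mul_of_nonneg_right hE (by positivity)
    _ = 16 * Real.exp 4 / L ^ 2 * (n * Real.exp (-(n * D ^ 2 / 4))) := by
        field_simp; norm_num
    _ ≤ 16 * Real.exp 4 / L ^ 2 * (4 / D ^ 2) := mul_le_mul_of_nonneg_left hG (by positivity)
    _ = _ := by field_simp; norm_num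

theorem inv_log_sq_le_threshold {T n : ℕ} (hn1 : 1 ≤ n) (hn : (n : ℝ) < Real.log T ^ 2)
    (hlog : 1 ≤ Real.log T) (hT : Real.log T ^ 4 ≤ T) : 1 / Real.log T ^ 2 ≤ threshold T n := by
  have hnT := le_of_lt_log_sq hn hlog hT
  have hnpos : (0 : ℝ) < n := by positivity
  refine Real.le_sqrt_of_sq_le ?_
  have h1 : 1 ≤ bonus T n := by
    have := log_sub_log_le_bonus hn1 hnT
    have := (log_le_log_of_le hn1 hnT).2
    linarith
  have h2 : (1 / Real.log T ^ 2) ^ 2 ≤ 1 / Real.log T ^ 2 := by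
    have h3 : 1 / Real.log T ^ 2 ≤ 1 := by
      rw [div_le_one (by positivity)]; exact one_le_pow₀ hlog
    have h4 : 0 ≤ 1 / Real.log T ^ 2 := by positivity
    nlinarith
  calc _ ≤ 1 / Real.log T ^ 2 := h2
    _ ≤ 1 / n := one_div_le_one_div_of_le hnpos hn.le
    _ ≤ 2 / (n : ℝ) * bonus T n := by
      rw [div_mul_eq_mul_div]
      exact div_le_div_of_nonneg_right (by linarith) hnpos.le

/-- The probability of a wrong commitment after Stage III is `O(1 / T + 1 / (T Δ²))`: each of the at
most `log² T` terms of the union bound is `O(1 / (T Δ² log² T))`. -/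
theorem IsSubgaussian.mul_measureReal_commit_le {ν : Fin 2 → Measure ℝ}
    [∀ k, IsProbabilityMeasure (ν k)] (h : IsSubgaussian ν) {k : Fin 2}
    (hk : mean ν (other k) = mean ν k + gap ν) (hgap : 0 < gap ν) {T : ℕ}
    (hlog : 2 ≤ Real.log T) (hT : Real.log T ^ 4 ≤ T) (b : Fin 2) :
    T * (tableLaw ν).real {x | (t₂ T (Real.log T ^ 10) b x : ℝ) < Real.log T ^ 2
        ∧ commit T (Real.log T ^ 10) b x = k} ≤ 4 + 64 * Real.exp 4 / gap ν ^ 2 := by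
  have hlog1 : 1 ≤ Real.log T := by linarith
  have hTpos : (0 : ℝ) < T := lt_of_lt_of_le (by positivity) hT
  have h1 := h.measureReal_commit_le hk T (T₁ := Real.log T ^ 10) (by positivity) b
    (r := 1 / Real.log T ^ 2) (by positivity) fun n hn1 hn => by
      linarith [inv_log_sq_le_threshold hn1 hn hlog1 hT]
  refine (mul_le_mul_of_nonneg_left h1 hTpos.le).trans ?_
  rw [mul_add, Finset.mul_sum]
  refine add_le_add ?_ ?_
  · have h2 : Real.log T ^ 10 * (1 / Real.log T ^ 2) ^ 2 / 2 = Real.log T ^ 6 / 2 := by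
      field_simp
    have h3 : Real.log T ≤ Real.log T ^ 6 / 2 := by
      have h4 : 2 ^ 5 ≤ Real.log T ^ 5 := pow_le_pow_left₀ (by norm_num) hlog 5
      have h5 : Real.log T ^ 6 = Real.log T * Real.log T ^ 5 := by ring
      nlinarith
    rw [h2]
    have h6 : T * Real.exp (-(Real.log T ^ 6 / 2)) ≤ 1 := by
      calc T * Real.exp (-(Real.log T ^ 6 / 2))
          ≤ T * Real.exp (-Real.log T) :=
            mul_le_mul_of_nonneg_left (Real.exp_le_exp.2 (by linarith)) hTpos.le
        _ = 1 := by rw [Real.exp_neg, Real.exp_log hTpos, mul_inv_cancel₀ hTpos.ne']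
    linarith
  · calc _ ≤ ∑ n ∈ Finset.Ico 1 ⌈Real.log T ^ 2⌉₊,
          64 * Real.exp 4 / gap ν ^ 2 / Real.log T ^ 2 := by
          refine Finset.sum_le_sum fun n hn => ?_
          obtain ⟨hn1, hn2⟩ := Finset.mem_Ico.1 hn
          exact exp_neg_threshold_le hn1 (Nat.lt_ceil.1 hn2) hlog1 hT hgap
      _ = ((⌈Real.log T ^ 2⌉₊ - 1 : ℕ) : ℝ)
          * (64 * Real.exp 4 / gap ν ^ 2 / Real.log T ^ 2) := by
          rw [Finset.sum_const, Nat.card_Ico, nsmul_eq_mul]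
      _ ≤ Real.log T ^ 2 * (64 * Real.exp 4 / gap ν ^ 2 / Real.log T ^ 2) := by
          refine mul_le_mul_of_nonneg_right ?_ (by positivity)
          have h2 := Nat.ceil_lt_add_one (sq_nonneg (Real.log T))
          have h3 : 1 ≤ ⌈Real.log T ^ 2⌉₊ := Nat.one_le_iff_ne_zero.2
            (Nat.ceil_pos.2 (by positivity)).ne'
          push_cast [h3]
          linarith
      _ = _ := by field_simp

/-! ### Upper bounds for the number of pulls of the inferior arm -/

section Upper

variable {ν : Fin 2 → Measure ℝ} [∀ k, IsProbabilityMeasure (ν k)]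

theorem integrable_indicator_const {s : Set Rewards} (hs : MeasurableSet s) (c : ℝ) :
    Integrable (s.indicator fun _ => c) (tableLaw ν) :=
  (integrable_const c).indicator hs

/-- The expected number of pulls of the inferior arm, stage by stage. The factor of the last term is
the cost of the second uniform exploration, which is independent of whether it takes place. -/
theorem IsSubgaussian.integral_pulls_le (h : IsSubgaussian ν) {k : Fin 2}
    (hk : mean ν (other k) = mean ν k + gap ν) (hgap : 0 < gap ν) {T : ℕ}
    (hlog : 2 ≤ Real.log T) (hT : Real.log T ^ 4 ≤ T) (b : Fin 2) :
    ∫ x, (pulls T (Real.log T ^ 10) b x k T : ℝ) ∂(tableLaw ν)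
      ≤ ∫ x, (τ₁ (Real.log T ^ 10) x : ℝ) ∂(tableLaw ν) + 128 / gap ν ^ 2
        + ∫ x, (t₂ T (Real.log T ^ 10) b x : ℝ) ∂(tableLaw ν) + (4 + 64 * Real.exp 4 / gap ν ^ 2)
        + (tableLaw ν).real {x | Real.log T ^ 2 ≤ t₂ T (Real.log T ^ 10) b x}
          * (1 + (80 + 32 * Real.posLog (2 * T * gap ν ^ 2)) / gap ν ^ 2) := by
  classical
  have hTpos : (0 : ℝ) < T := lt_of_lt_of_le (by positivity) hT
  set T₁ := Real.log T ^ 10 with hT₁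
  have hT₁1 : 1 ≤ T₁ := one_le_pow₀ (by linarith)
  have hT₁0 : 0 ≤ T₁ := by linarith
  set D := gap ν with hD
  set M : ℝ := ((⌊T₁⌋₊ + 1 : ℕ) : ℝ) with hM
  let A : Set Rewards := {x | Real.log T ^ 2 ≤ t₂ T T₁ b x}
  let B : Set Rewards := {x | lead T₁ b x = k}
  let W : Set Rewards := {x | (t₂ T T₁ b x : ℝ) < Real.log T ^ 2 ∧ commit T T₁ b x = k}
  let E : Set Rewards := {y | lead (2 * T) b y = k}
  let f : Rewards → ℝ := fun y => (τ₁ (2 * T) y : ℝ) + E.indicator (fun _ => (T : ℝ)) y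
  have hcast : Measurable fun x => (t₂ T T₁ b x : ℝ) :=
    measurable_from_nat.comp (measurable_t₂ T T₁ b)
  have hA : MeasurableSet A := measurableSet_le measurable_const hcast
  have hB : MeasurableSet B := measurable_lead T₁ b (measurableSet_singleton k)
  have hW : MeasurableSet W := (measurableSet_lt hcast measurable_const).inter
    (measurable_commit T T₁ b (measurableSet_singleton k))
  have hE : MeasurableSet E := measurable_lead (2 * T) b (measurableSet_singleton k)
  have hτ₁2 : ∀ y, τ₁ (2 * T) y ≤ ⌊(2 * T : ℝ)⌋₊ + 1 := τ₁_le_floor (by positivity)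
  have hτint : Integrable (fun y => (τ₁ (2 * T) y : ℝ)) (tableLaw ν) :=
    integrable_natCast (measurable_τ₁ _) hτ₁2
  have hf : Measurable f :=
    (measurable_from_nat.comp (measurable_τ₁ _)).add (measurable_const.indicator hE)
  have hfint : ∫ y, f y ∂(tableLaw ν) ≤ 1 + (80 + 32 * Real.posLog (2 * T * D ^ 2)) / D ^ 2 := by
    rw [integral_add hτint (integrable_indicator_const hE _), integral_indicator_const _ hE,
      smul_eq_mul]
    have h1 := h.integral_τ₁_le hgap (T₁ := 2 * T) (by positivity)
    have h2 := h.measureReal_lead_le hk hgap (T₁ := 2 * T) (by positivity) b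
    have h3 := mul_le_mul_of_nonneg_right h2 hTpos.le
    have h4 : 64 / (2 * T * D ^ 2) * T = 32 / D ^ 2 := by field_simp; norm_num
    have h5 : (80 + 32 * Real.posLog (2 * T * D ^ 2)) / D ^ 2
        = (48 + 32 * Real.posLog (2 * T * D ^ 2)) / D ^ 2 + 32 / D ^ 2 := by ring
    rw [h5]
    linarith
  have hshift : Measurable fun x => f (shift (pulls₃ T T₁ b x) x) :=
    hf.comp (measurable_shift_stoppingRule (measurable_pulls₃ T T₁ b))
  have hAint : Integrable (A.indicator fun x => f (shift (pulls₃ T T₁ b x) x)) (tableLaw ν) := by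
    refine Integrable.of_bound (hshift.indicator hA).aestronglyMeasurable
      ((⌊(2 * T : ℝ)⌋₊ + 1 : ℕ) + T) (ae_of_all _ fun x => ?_)
    refine (norm_indicator_le_norm_self _ _).trans ?_
    have h1 : ((τ₁ (2 * T) (shift (pulls₃ T T₁ b x) x) : ℕ) : ℝ) ≤ (⌊(2 * T : ℝ)⌋₊ + 1 : ℕ) := by
      exact_mod_cast hτ₁2 _
    have h2 : 0 ≤ E.indicator (fun _ => (T : ℝ)) (shift (pulls₃ T T₁ b x) x) :=
      Set.indicator_nonneg (fun _ _ => hTpos.le) _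
    have h3 : E.indicator (fun _ => (T : ℝ)) (shift (pulls₃ T T₁ b x) x) ≤ T :=
      Set.indicator_le_self' (fun _ _ => hTpos.le) _
    rw [Real.norm_of_nonneg (add_nonneg (Nat.cast_nonneg _) h2)]
    exact add_le_add h1 h3
  have hpoint : ∀ x, (pulls T T₁ b x k T : ℝ) ≤ (τ₁ T₁ x : ℝ) + B.indicator (fun _ => M) x
      + t₂ T T₁ b x + W.indicator (fun _ => (T : ℝ)) x
      + A.indicator (fun x => f (shift (pulls₃ T T₁ b x) x)) x := by
    intro x
    have h1 := pulls_le_add T T₁ b x k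
    rw [τ₃_eq, commit'_eq, pulls₂_eq hT₁0] at h1
    have h2 : (pulls T T₁ b x k T : ℝ) ≤ _ := Nat.cast_le.2 h1
    refine h2.trans_eq ?_
    simp only [Nat.cast_add (R := ℝ), Nat.cast_ite, Nat.cast_zero, Set.indicator_apply, f, A, B, W,
      E, Set.mem_ofPred_eq, hM]
  have hi1 : Integrable (fun x => (τ₁ T₁ x : ℝ)) (tableLaw ν) :=
    integrable_natCast (measurable_τ₁ _) (τ₁_le_floor hT₁0)
  have hi2 := integrable_indicator_const (ν := ν) hB M
  have hi3 : Integrable (fun x => (t₂ T T₁ b x : ℝ)) (tableLaw ν) :=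
    integrable_natCast (measurable_t₂ T T₁ b) (t₂_le T T₁ b)
  have hi4 := integrable_indicator_const (ν := ν) hW (T : ℝ)
  have hi12 := hi1.add hi2
  have hi123 := hi12.add hi3
  have hi1234 := hi123.add hi4
  refine (integral_mono (integrable_natCast (measurable_pulls T T₁ b k T)
    fun x => pulls_le T T₁ b x k T) (hi1234.add hAint) hpoint).trans ?_
  rw [integral_add' hi1234 hAint, integral_add' hi123 hi4, integral_add' hi12 hi3,
    integral_add' hi1 hi2, integral_indicator_const _ hB, integral_indicator_const _ hW,
    integral_indicator_shift ν (isStoppingRule_pulls₃ T T₁ b) hA (fun x y hxy hx => by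
      change Real.log T ^ 2 ≤ (t₂ T T₁ b y : ℝ)
      rw [t₂_congr (x := x) hxy]
      exact hx) hf, smul_eq_mul, smul_eq_mul]
  have hBle : (tableLaw ν).real B * M ≤ 128 / D ^ 2 := by
    have h1 := h.measureReal_lead_le hk hgap (T₁ := T₁) (by linarith) b
    have h2 : M ≤ 2 * T₁ := by
      rw [hM]
      push_cast
      linarith [Nat.floor_le hT₁0]
    calc (tableLaw ν).real B * M ≤ 64 / (T₁ * D ^ 2) * (2 * T₁) :=
          mul_le_mul h1 h2 (Nat.cast_nonneg _) (by positivity)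
      _ = 128 / D ^ 2 := by
          have : T₁ ≠ 0 := by positivity
          field_simp
          norm_num
  have hWle := h.mul_measureReal_commit_le hk hgap hlog hT b
  have hAle := mul_le_mul_of_nonneg_left hfint (measureReal_nonneg (μ := tableLaw ν) (s := A))
  rw [mul_comm (T : ℝ)] at hWle
  change _ + _ + _ + _ + _ ≤ _
  linarith

/-- `E t₂ ≤ (2 + o(1)) log T / Δ²`, with the deviation `ε Δ` allowed for the averages. -/
theorem IsSubgaussian.integral_t₂_le_log (h : IsSubgaussian ν) (hgap : 0 < gap ν) {T : ℕ}
    (hlog : 1 ≤ Real.log T) (hT : Real.log T ^ 4 ≤ T) (b : Fin 2) {ε : ℝ} (hε : 0 < ε)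
    (hε' : ε < 1 / 2) :
    ∫ x, (t₂ T (Real.log T ^ 10) b x : ℝ) ∂(tableLaw ν)
      ≤ 2 / ((1 - 2 * ε) ^ 2 * gap ν ^ 2) * (2 + Real.log T + 2 * Real.log (Real.log T))
        + (1 + 16 / (ε ^ 2 * gap ν ^ 2)) := by
  set D := gap ν with hD
  set L := Real.log T with hL
  have hε2 : 0 < 1 - 2 * ε := by linarith
  have hlogL : 0 ≤ Real.log (L ^ 2 + 1) := Real.log_nonneg (by nlinarith)
  set A : ℝ := 2 / ((1 - 2 * ε) ^ 2 * D ^ 2) * (1 + L + Real.log (L ^ 2 + 1)) with hA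
  have hA0 : 0 < A := by positivity
  have hm1 : 1 ≤ ⌈A⌉₊ := Nat.one_le_iff_ne_zero.2 (Nat.ceil_pos.2 hA0).ne'
  have h1 := h.integral_t₂_le T (T₁ := L ^ 10) (by positivity) b (r := ε * D) (by positivity) hm1
    fun n hn hnL => by
      have hn1 : 1 ≤ n := hm1.trans hn
      have hnpos : (0 : ℝ) < n := by positivity
      have hnT := le_of_lt_log_sq hnL hlog hT
      have hb := bonus_le hn1 hnT
      have hnA : A ≤ n := Nat.ceil_le.1 hn
      rw [hA, div_mul_eq_mul_div, div_le_iff₀ (by positivity)] at hnA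
      refine Real.sqrt_le_iff.2 ⟨?_, ?_⟩
      · rw [← hD]; nlinarith
      · rw [div_mul_eq_mul_div, div_le_iff₀ hnpos, ← hD]
        nlinarith
  have h2 : Real.log (L ^ 2 + 1) ≤ 1 + 2 * Real.log L := by
    have h3 : Real.log (L ^ 2 + 1) ≤ Real.log (2 * L ^ 2) :=
      Real.log_le_log (by positivity) (by nlinarith)
    rw [Real.log_mul (by norm_num) (by positivity), Real.log_pow] at h3
    have h4 := Real.log_two_lt_d9
    push_cast at h3
    linarith
  have h3 : A ≤ 2 / ((1 - 2 * ε) ^ 2 * D ^ 2) * (2 + L + 2 * Real.log L) :=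
    mul_le_mul_of_nonneg_left (by linarith) (by positivity)
  have h4 : L ^ 2 * (4 * Real.exp (-(L ^ 10 * (ε * D) ^ 2 / 2))) ≤ 8 / (ε * D) ^ 2 := by
    have hu : 0 < L ^ 10 * (ε * D) ^ 2 / 2 := by positivity
    have h5 : Real.exp (-(L ^ 10 * (ε * D) ^ 2 / 2)) ≤ 1 / (L ^ 10 * (ε * D) ^ 2 / 2) := by
      rw [Real.exp_neg, ← one_div]
      exact one_div_le_one_div_of_le hu (by linarith [Real.add_one_le_exp (L ^ 10 * (ε * D) ^ 2 / 2)])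
    calc L ^ 2 * (4 * Real.exp (-(L ^ 10 * (ε * D) ^ 2 / 2)))
        ≤ L ^ 2 * (4 * (1 / (L ^ 10 * (ε * D) ^ 2 / 2))) :=
          mul_le_mul_of_nonneg_left (by linarith) (by positivity)
      _ = 8 / (ε * D) ^ 2 * (1 / L ^ 8) := by field_simp; norm_num
      _ ≤ 8 / (ε * D) ^ 2 := by
          refine mul_le_of_le_one_right (by positivity) ?_
          rw [div_le_one (by positivity)]
          exact one_le_pow₀ hlog
  have h5 := (Nat.ceil_lt_add_one hA0.le).le
  have h6 : 16 / (ε ^ 2 * D ^ 2) = 8 / (ε * D) ^ 2 + 8 / (ε * D) ^ 2 := by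
    rw [mul_pow]; ring
  rw [h6]
  linarith

/-! ### The bound that holds uniformly in the bandit -/

/-- Here `log T` of `integral_t₂_le_log` is replaced by `log (T Δ²)`, which can be much smaller. -/
theorem IsSubgaussian.integral_t₂_le_uniform (h : IsSubgaussian ν) (hgap : 0 < gap ν) {T : ℕ}
    (hlog : 2 ≤ Real.log T) (hT : Real.log T ^ 4 ≤ T) (b : Fin 2)
    (hTD : 1 ≤ Real.log (T * gap ν ^ 2)) :
    ∫ x, (t₂ T (Real.log T ^ 10) b x : ℝ) ∂(tableLaw ν)
      ≤ 2 + 350 * Real.log (T * gap ν ^ 2) / gap ν ^ 2 := by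
  set D := gap ν with hD
  set L := Real.log T with hL
  set l := Real.log (T * D ^ 2) with hl
  have hTpos : (0 : ℝ) < T := lt_of_lt_of_le (by positivity) hT
  rcases le_total (D * L) 1 with hc | hc
  · -- The cap `log² T` on the length of the stage suffices.
    have h1 : ∫ x, (t₂ T (L ^ 10) b x : ℝ) ∂(tableLaw ν) ≤ L ^ 2 + 1 := by
      have h2 : ∀ x, (t₂ T (L ^ 10) b x : ℝ) ≤ L ^ 2 + 1 := fun x => by
        have h3 : (t₂ T (L ^ 10) b x : ℝ) ≤ ((⌊L ^ 2⌋₊ + 1 : ℕ) : ℝ) :=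
          Nat.cast_le.2 (t₂_le T (L ^ 10) b x)
        rw [Nat.cast_add, Nat.cast_one] at h3
        linarith [Nat.floor_le (sq_nonneg L)]
      have h4 := integral_mono (μ := tableLaw ν)
        (integrable_natCast (measurable_t₂ T (L ^ 10) b) (t₂_le T (L ^ 10) b))
        (integrable_const _) h2
      simpa using h4
    have h2 : L ^ 2 ≤ 350 * l / D ^ 2 := by
      rw [le_div_iff₀ (by positivity)]
      have h3 : (D * L) ^ 2 ≤ 1 := pow_le_one₀ (by positivity) hc
      nlinarith
    linarith
  · have h1 : L ≤ 2 * l := by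
      -- `T Δ² ≥ T / log² T ≥ √T`
      have h2 : (T : ℝ) ≤ (T * D ^ 2) ^ 2 := by
        have h3 : 1 ≤ (D * L) ^ 4 := one_le_pow₀ hc
        calc (T : ℝ) ≤ T * (D * L) ^ 4 := le_mul_of_one_le_right hTpos.le h3
          _ = T * (L ^ 4 * D ^ 4) := by ring
          _ ≤ T * (T * D ^ 4) := by gcongr
          _ = _ := by ring
      have h3 := Real.log_le_log hTpos h2
      rw [Real.log_pow] at h3
      exact_mod_cast h3
    have h2 := h.integral_t₂_le_log hgap (by linarith) hT b (ε := 1 / 4) (by norm_num)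
      (by norm_num)
    rw [← hD, ← hL] at h2
    have h3 : Real.log L ≤ L := by
      have := Real.log_le_sub_one_of_pos (show 0 < L by linarith)
      linarith
    refine h2.trans ?_
    have h4 : 2 / ((1 - 2 * (1 / 4 : ℝ)) ^ 2 * D ^ 2) * (2 + L + 2 * Real.log L)
        ≤ (64 * l) / D ^ 2 := by
      have h5 : 2 / ((1 - 2 * (1 / 4 : ℝ)) ^ 2 * D ^ 2) = 8 / D ^ 2 := by field_simp; norm_num
      rw [h5, div_mul_eq_mul_div]
      exact div_le_div_of_nonneg_right (by linarith) (by positivity)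
    have h6 : 16 / ((1 / 4 : ℝ) ^ 2 * D ^ 2) ≤ 256 * l / D ^ 2 := by
      have h7 : 16 / ((1 / 4 : ℝ) ^ 2 * D ^ 2) = 256 / D ^ 2 := by field_simp; norm_num
      rw [h7]
      exact div_le_div_of_nonneg_right (by linarith) (by positivity)
    have h8 : 350 * l / D ^ 2 = (64 * l) / D ^ 2 + 256 * l / D ^ 2 + 30 * l / D ^ 2 := by ring
    have h9 : 0 ≤ 30 * l / D ^ 2 := by positivity
    rw [h8]
    linarith

theorem IsSubgaussian.integral_pulls_le_uniform (h : IsSubgaussian ν) {k : Fin 2}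
    (hk : mean ν (other k) = mean ν k + gap ν) (hgap : 0 < gap ν) {T : ℕ}
    (hlog : 2 ≤ Real.log T) (hT : Real.log T ^ 10 ≤ T) (b : Fin 2)
    (hTD : 1 ≤ Real.log (T * gap ν ^ 2)) :
    ∫ x, (pulls T (Real.log T ^ 10) b x k T : ℝ) ∂(tableLaw ν)
      ≤ 8 + 6000 * Real.log (T * gap ν ^ 2) / gap ν ^ 2 := by
  have hT4 : Real.log T ^ 4 ≤ T :=
    (pow_le_pow_right₀ (by linarith) (by norm_num)).trans hT
  have hTpos : (0 : ℝ) < T := lt_of_lt_of_le (by positivity) hT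
  have h1 := h.integral_pulls_le hk hgap hlog hT4 b
  have h2 := h.integral_τ₁_le hgap (T₁ := Real.log T ^ 10) (by positivity)
  have h3 := h.integral_t₂_le_uniform hgap hlog hT4 b hTD
  set D := gap ν with hD
  set l := Real.log (T * D ^ 2) with hl
  have hpl : Real.posLog (T * D ^ 2) = l := max_eq_right (by linarith)
  have h4 : Real.posLog (Real.log T ^ 10 * D ^ 2) ≤ l := by
    rw [← hpl]
    exact Real.posLog_le_posLog (by positivity) (by gcongr)
  have h5 : Real.posLog (2 * T * D ^ 2) ≤ l + 1 := by
    rw [mul_assoc]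
    refine Real.posLog_mul.trans ?_
    rw [hpl, Real.posLog_eq_log (by norm_num)]
    linarith [Real.log_two_lt_d9]
  have h6 : (tableLaw ν).real {x | Real.log T ^ 2 ≤ t₂ T (Real.log T ^ 10) b x}
      * (1 + (80 + 32 * Real.posLog (2 * T * D ^ 2)) / D ^ 2)
      ≤ 1 + (80 + 32 * (l + 1)) / D ^ 2 := by
    have h7 : 1 + (80 + 32 * Real.posLog (2 * T * D ^ 2)) / D ^ 2
        ≤ 1 + (80 + 32 * (l + 1)) / D ^ 2 := by gcongr
    have h8 : 0 ≤ 1 + (80 + 32 * Real.posLog (2 * T * D ^ 2)) / D ^ 2 := by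
      have := Real.posLog_nonneg (x := 2 * T * D ^ 2)
      positivity
    exact (mul_le_of_le_one_left h8 measureReal_le_one).trans h7
  have h7 : (48 + 32 * Real.posLog (Real.log T ^ 10 * D ^ 2)) / D ^ 2
      ≤ (48 + 32 * l) / D ^ 2 := by gcongr
  have hexp : Real.exp 4 ≤ 82 := by
    have h8 : Real.exp 4 = Real.exp 1 ^ 4 := by rw [← Real.exp_nat_mul]; norm_num
    have h9 := Real.exp_one_lt_d9
    rw [h8]
    calc Real.exp 1 ^ 4 ≤ 3 ^ 4 := by gcongr; linarith
      _ ≤ 82 := by norm_num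
  have h8 : (48 + 32 * l) / D ^ 2 + 128 / D ^ 2 + 350 * l / D ^ 2 + 64 * Real.exp 4 / D ^ 2
      + (80 + 32 * (l + 1)) / D ^ 2 ≤ 6000 * l / D ^ 2 := by
    rw [← add_div, ← add_div, ← add_div, ← add_div]
    exact div_le_div_of_nonneg_right (by linarith) (by positivity)
  linarith

end Upper

/-! ### The limit of the regret over `log T` -/

section Limit

variable {ν : Fin 2 → Measure ℝ} [∀ k, IsProbabilityMeasure (ν k)]

theorem tendsto_log_natCast : Tendsto (fun T : ℕ => Real.log T) atTop atTop :=
  Real.tendsto_log_atTop.comp tendsto_natCast_atTop_atTop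

theorem eventually_log_pow_le (n : ℕ) : ∀ᶠ T : ℕ in atTop, Real.log T ^ n ≤ T := by
  have h := (Real.isLittleO_pow_log_id_atTop (n := n)).bound one_pos
  filter_upwards [tendsto_natCast_atTop_atTop.eventually h] with T hT
  simp only [one_mul, Real.norm_eq_abs, id, Nat.abs_cast] at hT
  exact (le_abs_self _).trans hT

/-- All stages but Stage III contribute `O(log log T)`, except for the second exploration, whose cost
`O(log T)` is multiplied with the probability `O(1 / log T)` that it takes place. -/
theorem IsSubgaussian.exists_integral_pulls_le (h : IsSubgaussian ν) {k : Fin 2}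
    (hk : mean ν (other k) = mean ν k + gap ν) (hgap : 0 < gap ν) (b : Fin 2) {ε : ℝ}
    (hε : 0 < ε) (hε' : ε < 1 / 2) :
    ∃ K : ℝ, ∀ T : ℕ, 2 ≤ Real.log T → Real.log T ^ 4 ≤ T →
      ∫ x, (pulls T (Real.log T ^ 10) b x k T : ℝ) ∂(tableLaw ν)
        ≤ K * (1 + Real.log (Real.log T))
          + (2 / ((1 - 2 * ε) ^ 2 * gap ν ^ 2) * (2 + Real.log T + 2 * Real.log (Real.log T)) + K)
            * (1 + K / Real.log T) := by
  set D := gap ν with hD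
  set p1 := Real.posLog (D ^ 2) with hp1
  set p2 := Real.posLog (2 * D ^ 2) with hp2
  have hp10 : 0 ≤ p1 := Real.posLog_nonneg
  have hp20 : 0 ≤ p2 := Real.posLog_nonneg
  set K1 := 5 + (176 + 32 * p1 + 64 * Real.exp 4) / D ^ 2 + 320 / D ^ 2 with hK1
  set K2 := 1 + 16 / (ε ^ 2 * D ^ 2) with hK2
  set K3 := 1 + (80 + 32 * p2) / D ^ 2 + 32 / D ^ 2 with hK3
  have hK10 : 0 ≤ K1 := by positivity
  have hK20 : 0 ≤ K2 := by positivity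
  have hK30 : 0 ≤ K3 := by positivity
  refine ⟨K1 + K2 + K3, fun T hlog hT => ?_⟩
  have h1 := h.integral_pulls_le hk hgap hlog hT b
  have h2 := h.integral_τ₁_le hgap (T₁ := Real.log T ^ 10) (by positivity)
  have h3 := h.integral_t₂_le_log hgap (by linarith) hT b hε hε'
  rw [← hD] at h1 h2 h3
  set L := Real.log T with hL
  set a := 2 / ((1 - 2 * ε) ^ 2 * D ^ 2) with ha
  have ha0 : 0 ≤ a := by positivity
  have hll : 0 ≤ Real.log L := Real.log_nonneg (by linarith)
  set E := ∫ x, (t₂ T (L ^ 10) b x : ℝ) ∂(tableLaw ν) with hE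
  set S := a * (2 + L + 2 * Real.log L) + K2 with hS
  have hS0 : 0 ≤ S := by positivity
  -- Markov's inequality for the event that the second exploration takes place.
  have hmarkov : (tableLaw ν).real {x | L ^ 2 ≤ t₂ T (L ^ 10) b x} ≤ S / L ^ 2 := by
    rw [le_div_iff₀ (by positivity), mul_comm]
    exact (mul_meas_ge_le_integral_of_nonneg (ae_of_all _ fun x => Nat.cast_nonneg _)
      (integrable_natCast (measurable_t₂ T (L ^ 10) b) (t₂_le T (L ^ 10) b)) (L ^ 2)).trans h3
  have hpos1 : Real.posLog (L ^ 10 * D ^ 2) ≤ 10 * Real.log L + p1 := by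
    refine Real.posLog_mul.trans (add_le_add_left ?_ p1)
    rw [Real.posLog_eq_log (by rw [abs_of_nonneg (by positivity)]; exact one_le_pow₀ (by linarith)),
      Real.log_pow]
    norm_num
  have hpos2 : Real.posLog (2 * T * D ^ 2) ≤ L + p2 := by
    rw [show (2 * T * D ^ 2 : ℝ) = T * (2 * D ^ 2) by ring]
    refine Real.posLog_mul.trans (add_le_add_left ?_ p2)
    rw [Real.posLog_eq_log_max_one (Nat.cast_nonneg T), max_eq_right]
    by_contra hc
    have : L ≤ 0 := Real.log_nonpos (Nat.cast_nonneg T) (not_le.1 hc).le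
    linarith
  have h4 : (48 + 32 * Real.posLog (L ^ 10 * D ^ 2)) / D ^ 2
      ≤ (48 + 32 * p1) / D ^ 2 + 320 / D ^ 2 * Real.log L := by
    rw [div_mul_eq_mul_div, ← add_div]
    exact div_le_div_of_nonneg_right (by linarith) (by positivity)
  have h5 : 1 + (80 + 32 * Real.posLog (2 * T * D ^ 2)) / D ^ 2 ≤ K3 * L := by
    have h6 : (80 + 32 * Real.posLog (2 * T * D ^ 2)) / D ^ 2
        ≤ (80 + 32 * p2) / D ^ 2 + 32 / D ^ 2 * L := by
      rw [div_mul_eq_mul_div, ← add_div]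
      exact div_le_div_of_nonneg_right (by linarith) (by positivity)
    have h7 : 0 ≤ (80 + 32 * p2) / D ^ 2 := by positivity
    rw [hK3]
    nlinarith
  have h6 : (tableLaw ν).real {x | L ^ 2 ≤ t₂ T (L ^ 10) b x}
      * (1 + (80 + 32 * Real.posLog (2 * T * D ^ 2)) / D ^ 2) ≤ S * (K3 / L) := by
    have h7 : 0 ≤ 1 + (80 + 32 * Real.posLog (2 * T * D ^ 2)) / D ^ 2 := by
      have := Real.posLog_nonneg (x := 2 * T * D ^ 2)
      positivity
    calc _ ≤ S / L ^ 2 * (K3 * L) := mul_le_mul hmarkov h5 h7 (by positivity)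
      _ = S * (K3 / L) := by
        have : L ≠ 0 := by positivity
        field_simp
  have h7 : 5 + (48 + 32 * p1) / D ^ 2 + 320 / D ^ 2 * Real.log L + 128 / D ^ 2
      + 64 * Real.exp 4 / D ^ 2 ≤ K1 * (1 + Real.log L) := by
    have h8 : K1 = 5 + (48 + 32 * p1) / D ^ 2 + 128 / D ^ 2 + 64 * Real.exp 4 / D ^ 2
        + 320 / D ^ 2 := by rw [hK1]; ring
    have h9 : 0 ≤ (K1 - 320 / D ^ 2) * Real.log L := by
      refine mul_nonneg ?_ hll
      rw [hK1]
      have : 0 ≤ 5 + (176 + 32 * p1 + 64 * Real.exp 4) / D ^ 2 := by positivity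
      linarith
    have h11 : K1 * (1 + Real.log L)
        = K1 + (K1 - 320 / D ^ 2) * Real.log L + 320 / D ^ 2 * Real.log L := by ring
    have h12 : 0 ≤ 320 / D ^ 2 := by positivity
    rw [h11]
    linarith
  have h8 : K1 * (1 + Real.log L) ≤ (K1 + K2 + K3) * (1 + Real.log L) :=
    mul_le_mul_of_nonneg_right (by linarith) (by linarith)
  have h9 : S * (1 + K3 / L) ≤ (a * (2 + L + 2 * Real.log L) + (K1 + K2 + K3))
      * (1 + (K1 + K2 + K3) / L) := by
    refine mul_le_mul (by linarith) (add_le_add_right ?_ _) (by positivity) (by positivity)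
    exact div_le_div_of_nonneg_right (by linarith) (by linarith)
  have h10 : S * (1 + K3 / L) = S + S * (K3 / L) := by ring
  linarith

theorem tendsto_upper (a K : ℝ) : Tendsto (fun L : ℝ => (K * (1 + Real.log L)
    + (a * (2 + L + 2 * Real.log L) + K) * (1 + K / L)) / L) atTop (𝓝 a) := by
  have h1 : Tendsto (fun L : ℝ => L⁻¹) atTop (𝓝 0) := tendsto_inv_atTop_zero
  have h2 : Tendsto (fun L : ℝ => Real.log L / L) atTop (𝓝 0) := by
    simpa using Real.isLittleO_log_id_atTop.tendsto_div_nhds_zero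
  have h3 : Tendsto (fun L : ℝ => K * (L⁻¹ + Real.log L / L)
      + (a * (2 * L⁻¹ + 1 + 2 * (Real.log L / L)) + K * L⁻¹) * (1 + K * L⁻¹)) atTop
      (𝓝 (K * (0 + 0) + (a * (2 * 0 + 1 + 2 * 0) + K * 0) * (1 + K * 0))) :=
    ((h1.add h2).const_mul K).add
      ((((((h1.const_mul 2).add_const 1).add (h2.const_mul 2)).const_mul a).add
        (h1.const_mul K)).mul ((h1.const_mul K).const_add 1))
  have h4 : K * (0 + 0) + (a * (2 * 0 + 1 + 2 * 0) + K * 0) * (1 + K * 0) = a := by ring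
  rw [h4] at h3
  refine h3.congr' ?_
  filter_upwards [eventually_gt_atTop 0] with L hL
  field_simp

/-- Stage III alone pulls the inferior arm `(2 - o(1)) log T / Δ²` times: until then its threshold
exceeds `(1 + c) / (1 - c) * Δ`. -/
theorem IsSubgaussian.le_integral_pulls (h : IsSubgaussian ν) {k : Fin 2}
    (hk : mean ν (other k) = mean ν k + gap ν) (hgap : 0 < gap ν) (b : Fin 2) {c : ℝ}
    (hc : 0 < c) (hc' : c < 1) {T : ℕ} (hlog : 6 ≤ Real.log T) (hT : Real.log T ^ 11 ≤ T)
    (hL : 2 * ((1 - c) ^ 3 / (1 + c) ^ 2) / gap ν ^ 2 < Real.log T)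
    (hL' : 2 * Real.log (Real.log T) ≤ c * Real.log T)
    (hL'' : 1 ≤ 2 * ((1 - c) ^ 3 / (1 + c) ^ 2) / gap ν ^ 2 * Real.log T) :
    (2 * ((1 - c) ^ 3 / (1 + c) ^ 2) / gap ν ^ 2 * Real.log T - 1)
      * (1 - 64 / (Real.log T ^ 10 * gap ν ^ 2)
        - (4 * Real.exp (-(Real.log T ^ 10 * (c * gap ν) ^ 2 / 2))
          + Real.log T ^ 2 * (4 * Real.exp (-(c ^ 2 / 2 * Real.log T)))))
      ≤ ∫ x, (pulls T (Real.log T ^ 10) b x k T : ℝ) ∂(tableLaw ν) := by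
  classical
  set D := gap ν with hD
  set L := Real.log T with hLdef
  have hL4 : L ^ 4 ≤ T := (pow_le_pow_right₀ (by linarith) (by norm_num)).trans hT
  set T₁ := L ^ 10 with hT₁
  have hT₁0 : 0 ≤ T₁ := by positivity
  have h1c : 0 < 1 - c := by linarith
  set κ := (1 - c) ^ 3 / (1 + c) ^ 2 with hκ
  have hκ0 : 0 < κ := by positivity
  set q := 2 * κ / D ^ 2 with hq
  have hq0 : 0 < q := by positivity
  set m := ⌊q * L⌋₊ with hm
  have hmle : (m : ℝ) ≤ q * L := Nat.floor_le (by positivity)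
  have hmge : q * L - 1 ≤ m := by linarith [Nat.lt_floor_add_one (q * L)]
  have hmL : (m : ℝ) < L ^ 2 := by nlinarith
  have hnm : ∀ n : ℕ, n ≤ m → (n : ℝ) < L ^ 2 := fun n hn =>
    (Nat.cast_le.2 hn).trans_lt hmL
  have hth : ∀ n : ℕ, 1 ≤ n → n ≤ m → (1 + c) * D ≤ (1 - c) * threshold T n := by
    intro n hn1 hnm'
    have hnL := hnm n hnm'
    have hnT := le_of_lt_log_sq hnL (by linarith) hL4
    have hnpos : (0 : ℝ) < n := by positivity
    have hb := log_sub_log_le_bonus hn1 hnT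
    have hlogn : Real.log n ≤ 2 * Real.log L := by
      have := Real.log_le_log hnpos hnL.le
      rw [Real.log_pow] at this
      exact_mod_cast this
    have hb' : (1 - c) * L ≤ bonus T n := by linarith
    have hnq : n * D ^ 2 ≤ 2 * κ * L := by
      have h2 : (n : ℝ) ≤ q * L := (Nat.cast_le.2 hnm').trans hmle
      calc n * D ^ 2 ≤ q * L * D ^ 2 := mul_le_mul_of_nonneg_right h2 (by positivity)
        _ = 2 * κ * L := by rw [hq]; field_simp
    -- `κ` is chosen such that `(1 - c) / κ = ((1 + c) / (1 - c)) ^ 2`.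
    have h3 : ((1 + c) * D) ^ 2 ≤ ((1 - c) * threshold T n) ^ 2 := by
      have h4 := sq_threshold hn1 hnT
      have h5 : n * ((1 + c) * D) ^ 2 ≤ n * ((1 - c) * threshold T n) ^ 2 := by
        calc n * ((1 + c) * D) ^ 2 = (1 + c) ^ 2 * (n * D ^ 2) := by ring
          _ ≤ (1 + c) ^ 2 * (2 * κ * L) := mul_le_mul_of_nonneg_left hnq (by positivity)
          _ = (1 - c) ^ 2 * (2 * ((1 - c) * L)) := by rw [hκ]; field_simp
          _ ≤ (1 - c) ^ 2 * (2 * bonus T n) := by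
            refine mul_le_mul_of_nonneg_left ?_ (by positivity)
            linarith
          _ = n * ((1 - c) * threshold T n) ^ 2 := by rw [← h4]; ring
      exact le_of_mul_le_mul_left h5 hnpos
    exact le_of_sq_le_sq h3 (mul_nonneg h1c.le (threshold_nonneg T n))
  have hthreshold := h.measureReal_t₂_le_le T hT₁0 b (r := c * D) (by positivity) hmL
    fun n hn1 hnm' => by
      have := hth n hn1 hnm'
      have h2 : (1 - c) * threshold T n ≤ threshold T n :=
        mul_le_of_le_one_left (threshold_nonneg T n) (by linarith)
      rw [← hD]
      linarith
  have hsum : ∑ n ∈ Finset.Icc 1 m,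
      4 * Real.exp (-(n * (threshold T n - gap ν - c * D) ^ 2 / 2))
      ≤ L ^ 2 * (4 * Real.exp (-(c ^ 2 / 2 * L))) := by
    calc _ ≤ ∑ n ∈ Finset.Icc 1 m, 4 * Real.exp (-(c ^ 2 / 2 * L)) := by
          refine Finset.sum_le_sum fun n hn => ?_
          obtain ⟨hn1, hnm'⟩ := Finset.mem_Icc.1 hn
          have hnL := hnm n hnm'
          have hnT := le_of_lt_log_sq hnL (by linarith) hL4
          refine mul_le_mul_of_nonneg_left (Real.exp_le_exp.2 (neg_le_neg ?_)) (by norm_num)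
          have h2 : c * threshold T n ≤ threshold T n - gap ν - c * D := by
            have := hth n hn1 hnm'
            rw [← hD]
            linarith
          have h3 : (c * threshold T n) ^ 2 ≤ (threshold T n - gap ν - c * D) ^ 2 :=
            pow_le_pow_left₀ (mul_nonneg hc.le (threshold_nonneg T n)) h2 2
          have h4 := sq_threshold hn1 hnT
          have h5 := log_sub_log_le_bonus hn1 hnT
          have h6 := two_mul_log_le hn1 hnL hL4
          calc c ^ 2 / 2 * L ≤ c ^ 2 * bonus T n := by
                have : L / 2 ≤ bonus T n := by linarith
                nlinarith [sq_nonneg c]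
            _ = n * (c * threshold T n) ^ 2 / 2 := by
                rw [mul_pow, mul_left_comm, h4]; ring
            _ ≤ n * (threshold T n - gap ν - c * D) ^ 2 / 2 := by
                gcongr
      _ = m * (4 * Real.exp (-(c ^ 2 / 2 * L))) := by
          rw [Finset.sum_const, Nat.card_Icc, nsmul_eq_mul, Nat.add_sub_cancel]
      _ ≤ _ := mul_le_mul_of_nonneg_right hmL.le (by positivity)
  have hlead := h.measureReal_lead_le hk hgap (T₁ := T₁) (by positivity) b
  have htime : ∀ x, time₃ T T₁ b x ≤ T := by
    intro x
    have h1 := τ₁_le_floor hT₁0 x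
    have h2 := pulls₂_eq hT₁0 x
    have h3 := t₂_le T T₁ b x
    have h4 : time₃ T T₁ b x ≤ 2 * (⌊T₁⌋₊ + 1) + (⌊L ^ 2⌋₊ + 1) := by
      rw [time₃, h2]
      exact add_le_add (by omega) h3
    have h5 : ((2 * (⌊T₁⌋₊ + 1) + (⌊L ^ 2⌋₊ + 1) : ℕ) : ℝ) ≤ T := by
      refine le_trans ?_ hT
      have h6 : L ^ 11 = L * L ^ 10 := by ring
      have h7 : L ^ 2 ≤ L ^ 10 := pow_le_pow_right₀ (by linarith) (by norm_num)
      have h8 : 1 ≤ L ^ 10 := one_le_pow₀ (by linarith)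
      have h9 := Nat.floor_le hT₁0
      have h10 := Nat.floor_le (sq_nonneg L)
      push_cast
      nlinarith
    exact h4.trans (by exact_mod_cast h5)
  -- The event that arm `k` is explored in Stage III for more than `m` steps.
  let G : Set Rewards := {x | lead T₁ b x ≠ k ∧ m < t₂ T T₁ b x}
  have hG : MeasurableSet G :=
    (measurable_lead T₁ b (measurableSet_singleton k)).compl.inter
      (measurableSet_lt measurable_const (measurable_t₂ T T₁ b))
  have hGc : Gᶜ ⊆ {x | lead T₁ b x = k} ∪ {x | t₂ T T₁ b x ≤ m} := by
    intro x hx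
    by_contra hc
    rw [Set.mem_union, not_or] at hc
    exact hx ⟨hc.1, not_le.1 hc.2⟩
  have hGp : 1 - 64 / (T₁ * D ^ 2) - (4 * Real.exp (-(T₁ * (c * D) ^ 2 / 2))
      + L ^ 2 * (4 * Real.exp (-(c ^ 2 / 2 * L)))) ≤ (tableLaw ν).real G := by
    have h1 := (measureReal_mono (μ := tableLaw ν) hGc).trans (measureReal_union_le _ _)
    rw [probReal_compl_eq_one_sub hG] at h1
    linarith
  have hpoint : ∀ x, G.indicator (fun _ => (m : ℝ)) x ≤ (pulls T T₁ b x k T : ℝ) := by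
    intro x
    rw [Set.indicator_apply]
    split_ifs with hx
    · exact Nat.cast_le.2 (hx.2.le.trans (t₂_le_pulls T T₁ b x (htime x) hx.1))
    · exact Nat.cast_nonneg _
  have hint := integral_mono (integrable_indicator_const (ν := ν) hG (m : ℝ))
    (integrable_natCast (measurable_pulls T T₁ b k T) fun x => pulls_le T T₁ b x k T) hpoint
  rw [integral_indicator_const _ hG, smul_eq_mul] at hint
  calc _ ≤ (q * L - 1) * (tableLaw ν).real G := mul_le_mul_of_nonneg_left hGp (by linarith)
    _ ≤ m * (tableLaw ν).real G := mul_le_mul_of_nonneg_right hmge measureReal_nonneg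
    _ = (tableLaw ν).real G * m := mul_comm _ _
    _ ≤ _ := hint

theorem tendsto_lower (q D : ℝ) (hD : 0 < D) {c : ℝ} (hc : 0 < c) :
    Tendsto (fun L : ℝ => (q * L - 1) * (1 - 64 / (L ^ 10 * D ^ 2)
      - (4 * Real.exp (-(L ^ 10 * (c * D) ^ 2 / 2))
        + L ^ 2 * (4 * Real.exp (-(c ^ 2 / 2 * L))))) / L) atTop (𝓝 q) := by
  have h0 : Tendsto (fun L : ℝ => L⁻¹) atTop (𝓝 0) := tendsto_inv_atTop_zero
  have h10 : Tendsto (fun L : ℝ => L ^ 10) atTop atTop := tendsto_pow_atTop (by norm_num)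
  have h1 : Tendsto (fun L : ℝ => 64 / (L ^ 10 * D ^ 2)) atTop (𝓝 0) :=
    tendsto_const_nhds.div_atTop (h10.atTop_mul_const (by positivity))
  have h2 : Tendsto (fun L : ℝ => 4 * Real.exp (-(L ^ 10 * (c * D) ^ 2 / 2))) atTop
      (𝓝 (4 * 0)) := by
    refine (Real.tendsto_exp_neg_atTop_nhds_zero.comp ?_).const_mul 4
    exact (h10.atTop_mul_const (by positivity)).atTop_div_const (by norm_num)
  have h3 : Tendsto (fun L : ℝ => L ^ 2 * (4 * Real.exp (-(c ^ 2 / 2 * L)))) atTop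
      (𝓝 (4 / (c ^ 2 / 2) ^ 2 * 0)) := by
    have h4 : Tendsto (fun L : ℝ => c ^ 2 / 2 * L) atTop atTop :=
      tendsto_id.const_mul_atTop (by positivity)
    refine (((Real.tendsto_pow_mul_exp_neg_atTop_nhds_zero 2).comp h4).const_mul
      (4 / (c ^ 2 / 2) ^ 2)).congr fun L => ?_
    simp only [Function.comp]
    field_simp
  have h5 := ((h0.const_sub q)).mul ((h1.const_sub 1).sub (h2.add h3))
  simp only [mul_zero, add_zero, sub_zero, mul_one] at h5
  refine h5.congr' ?_
  filter_upwards [eventually_gt_atTop 0] with L hL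
  have h6 : q - L⁻¹ = (q * L - 1) / L := by field_simp
  rw [h6, div_mul_eq_mul_div]

theorem IsSubgaussian.tendsto_integral_pulls (h : IsSubgaussian ν) {k : Fin 2}
    (hk : mean ν (other k) = mean ν k + gap ν) (hgap : 0 < gap ν) (b : Fin 2) :
    Tendsto (fun T : ℕ => (∫ x, (pulls T (Real.log T ^ 10) b x k T : ℝ) ∂(tableLaw ν))
      / Real.log T) atTop (𝓝 (2 / gap ν ^ 2)) := by
  set D := gap ν with hD
  have hlogT := tendsto_log_natCast
  refine tendsto_order.2 ⟨fun a ha => ?_, fun a ha => ?_⟩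
  · have hκ : Tendsto (fun c : ℝ => 2 * ((1 - c) ^ 3 / (1 + c) ^ 2) / D ^ 2) (𝓝[>] 0)
        (𝓝 (2 / D ^ 2)) := by
      have : ContinuousAt (fun c : ℝ => 2 * ((1 - c) ^ 3 / (1 + c) ^ 2) / D ^ 2) 0 := by
        refine ContinuousAt.div_const (ContinuousAt.mul continuousAt_const
          (ContinuousAt.div (by fun_prop) (by fun_prop) (by norm_num))) _
      have h1 := this.tendsto.mono_left (nhdsWithin_le_nhds (s := Set.Ioi 0))
      norm_num at h1
      exact h1
    obtain ⟨c, hca, hc0, hc1⟩ : ∃ c : ℝ, a < 2 * ((1 - c) ^ 3 / (1 + c) ^ 2) / D ^ 2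
        ∧ 0 < c ∧ c < 1 := by
      have h1 := (hκ.eventually (lt_mem_nhds ha)).and
        (Ioo_mem_nhdsGT (show (0 : ℝ) < 1 by norm_num))
      obtain ⟨c, h2, h3⟩ := h1.exists
      exact ⟨c, h2, h3.1, h3.2⟩
    have h1c : 0 < 1 - c := by linarith
    set q := 2 * ((1 - c) ^ 3 / (1 + c) ^ 2) / D ^ 2 with hq
    have hq0 : 0 < q := by positivity
    have hev := hlogT.eventually ((tendsto_lower q D hgap hc0).eventually (lt_mem_nhds hca))
    have hll : ∀ᶠ L : ℝ in atTop, 2 * Real.log L ≤ c * L := by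
      filter_upwards [Real.isLittleO_log_id_atTop.bound (show 0 < c / 2 by positivity),
        eventually_gt_atTop 0] with L hL hL0
      rw [Real.norm_eq_abs, Real.norm_eq_abs, id, abs_of_pos hL0] at hL
      linarith [le_abs_self (Real.log L)]
    filter_upwards [hev, hlogT.eventually hll, hlogT.eventually_ge_atTop 6, eventually_log_pow_le 11,
      hlogT.eventually_gt_atTop q, hlogT.eventually_ge_atTop (1 / q)] with T h1 h2 h3 h4 h5 h6
    refine h1.trans_le (div_le_div_of_nonneg_right ?_ (by linarith))
    refine h.le_integral_pulls hk hgap b hc0 hc1 h3 h4 h5 h2 ?_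
    rw [div_le_iff₀ hq0, mul_comm] at h6
    exact h6
  · have hκ : Tendsto (fun ε : ℝ => 2 / ((1 - 2 * ε) ^ 2 * D ^ 2)) (𝓝[>] 0)
        (𝓝 (2 / D ^ 2)) := by
      have : ContinuousAt (fun ε : ℝ => 2 / ((1 - 2 * ε) ^ 2 * D ^ 2)) 0 := by
        refine ContinuousAt.div continuousAt_const (by fun_prop) ?_
        norm_num
        exact hgap.ne'
      have h1 := this.tendsto.mono_left (nhdsWithin_le_nhds (s := Set.Ioi 0))
      norm_num at h1
      exact h1
    obtain ⟨ε, hεa, hε0, hε1⟩ : ∃ ε : ℝ, 2 / ((1 - 2 * ε) ^ 2 * D ^ 2) < a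
        ∧ 0 < ε ∧ ε < 1 / 2 := by
      have h1 := (hκ.eventually (gt_mem_nhds ha)).and
        (Ioo_mem_nhdsGT (show (0 : ℝ) < 1 / 2 by norm_num))
      obtain ⟨c, h2, h3⟩ := h1.exists
      exact ⟨c, h2, h3.1, h3.2⟩
    obtain ⟨K, hK⟩ := h.exists_integral_pulls_le hk hgap b hε0 hε1
    have hev := hlogT.eventually ((tendsto_upper (2 / ((1 - 2 * ε) ^ 2 * D ^ 2)) K).eventually
      (gt_mem_nhds hεa))
    filter_upwards [hev, hlogT.eventually_ge_atTop 2, eventually_log_pow_le 4] with T h1 h2 h3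
    exact (div_le_div_of_nonneg_right (hK T h2 h3) (by linarith)).trans_lt h1

theorem IsSubgaussian.tendsto_regret (h : IsSubgaussian ν) (hgap : 0 < gap ν) (b : Fin 2) :
    Tendsto (fun T : ℕ => regret ν T (Real.log T ^ 10) b / Real.log T) atTop
      (𝓝 (2 / gap ν)) := by
  obtain ⟨k, hk⟩ := exists_inferior ν
  have h1 := (h.tendsto_integral_pulls hk hgap b).const_mul (gap ν)
  have h2 : gap ν * (2 / gap ν ^ 2) = 2 / gap ν := by field_simp
  rw [h2] at h1
  refine h1.congr fun T => ?_
  rw [h.regret_eq T _ b hk, mul_div_assoc]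

end Limit

/-! ### The minimax bound -/

theorem exists_regret_le : ∃ C : ℝ, 0 < C ∧
    ∀ (ν : Fin 2 → Measure ℝ) [∀ k, IsProbabilityMeasure (ν k)], IsSubgaussian ν →
      ∀ (b : Fin 2) (T : ℕ), 16 * Real.exp 3 ≤ T * gap ν ^ 2 →
        regret ν T (Real.log T ^ 10) b
          ≤ C * (gap ν + Real.log (T * gap ν ^ 2) / gap ν) := by
  obtain ⟨T₀, hT₀⟩ := eventually_atTop.1
    ((tendsto_log_natCast.eventually_ge_atTop 2).and (eventually_log_pow_le 10))
  refine ⟨6000 + T₀, by positivity, fun ν _ h b T hT => ?_⟩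
  have hexp : 1 ≤ Real.exp 3 := Real.one_le_exp (by norm_num)
  have hlog : 1 ≤ Real.log (T * gap ν ^ 2) := by
    rw [Real.le_log_iff_exp_le (by linarith)]
    have := Real.exp_le_exp.2 (show (1 : ℝ) ≤ 3 by norm_num)
    linarith
  have hgap : 0 < gap ν := by
    refine lt_of_le_of_ne (abs_nonneg _) fun h0 => ?_
    rw [← h0] at hT
    norm_num at hT
    linarith
  obtain ⟨k, hk⟩ := exists_inferior ν
  rw [h.regret_eq T _ b hk]
  set D := gap ν with hD
  set l := Real.log (T * D ^ 2) with hl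
  have hlD : 0 < l / D := by positivity
  rcases le_total T₀ T with hTT | hTT
  · obtain ⟨h1, h2⟩ := hT₀ T hTT
    have h3 := h.integral_pulls_le_uniform hk hgap h1 h2 b hlog
    calc D * ∫ x, (pulls T (Real.log T ^ 10) b x k T : ℝ) ∂(tableLaw ν)
        ≤ D * (8 + 6000 * l / D ^ 2) := mul_le_mul_of_nonneg_left h3 hgap.le
      _ = 8 * D + 6000 * (l / D) := by field_simp
      _ ≤ (6000 + T₀) * (D + l / D) := by
        have : (0 : ℝ) ≤ T₀ := Nat.cast_nonneg _
        nlinarith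
  · -- For bounded `T` the trivial bound `T Δ` suffices.
    have h1 : ∫ x, (pulls T (Real.log T ^ 10) b x k T : ℝ) ∂(tableLaw ν) ≤ T₀ := by
      have h2 := integral_mono (μ := tableLaw ν)
        (integrable_natCast (measurable_pulls T (Real.log T ^ 10) b k T)
          fun x => pulls_le T (Real.log T ^ 10) b x k T) (integrable_const (T₀ : ℝ))
        fun x => Nat.cast_le.2 ((pulls_le T (Real.log T ^ 10) b x k T).trans hTT)
      simpa using h2
    have h3 : (0 : ℝ) ≤ T₀ := Nat.cast_nonneg _
    nlinarith

theorem log_div_le_two_mul_sqrt {T D : ℝ} (hT : 0 ≤ T) (hD : 0 < D) :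
    Real.log (T * D ^ 2) / D ≤ 2 * √T := by
  rw [div_le_iff₀ hD]
  have h1 : T * D ^ 2 = (√T * D) ^ 2 := by rw [mul_pow, Real.sq_sqrt hT]
  have h2 := Real.log_le_self (show 0 ≤ √T * D by positivity)
  rw [h1, Real.log_pow]
  push_cast
  linarith

end DETC

theorem theorem3 :
    (∀ (ν : Fin 2 → Measure ℝ) [∀ k, IsProbabilityMeasure (ν k)], DETC.IsSubgaussian ν →
      ∀ (b : Fin 2) (T : ℕ),
        Integrable (DETC.totalReward T (Real.log T ^ 10) b) (DETC.tableLaw ν)) ∧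
    (∀ (ν : Fin 2 → Measure ℝ) [∀ k, IsProbabilityMeasure (ν k)], DETC.IsSubgaussian ν →
      0 < DETC.gap ν → ∀ b : Fin 2,
        Tendsto (fun T : ℕ => DETC.regret ν T (Real.log T ^ 10) b / Real.log T) atTop
          (𝓝 (2 / DETC.gap ν))) ∧
    (∃ C : ℝ, 0 < C ∧
      ∀ (ν : Fin 2 → Measure ℝ) [∀ k, IsProbabilityMeasure (ν k)], DETC.IsSubgaussian ν →
      ∀ (b : Fin 2) (T : ℕ), 16 * Real.exp 3 ≤ T * DETC.gap ν ^ 2 →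
        DETC.regret ν T (Real.log T ^ 10) b
            ≤ C * (DETC.gap ν + Real.log (T * DETC.gap ν ^ 2) / DETC.gap ν) ∧
        DETC.regret ν T (Real.log T ^ 10) b ≤ C * (DETC.gap ν + √T)) := by
  refine ⟨fun ν _ h b T => h.integrable_totalReward T _ b,
    fun ν _ h hgap b => h.tendsto_regret hgap b, ?_⟩
  obtain ⟨C, hC, hreg⟩ := DETC.exists_regret_le
  refine ⟨2 * C, by positivity, fun ν _ h b T hT => ?_⟩
  have hgap : 0 < DETC.gap ν := by
    refine lt_of_le_of_ne (abs_nonneg _) fun h0 => ?_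
    rw [← h0] at hT
    norm_num at hT
    linarith [Real.exp_pos 3]
  have hlog : 0 ≤ Real.log (T * DETC.gap ν ^ 2) / DETC.gap ν := by
    refine div_nonneg (Real.log_nonneg ?_) hgap.le
    linarith [Real.one_le_exp (show (0 : ℝ) ≤ 3 by norm_num)]
  have h1 := hreg ν h b T hT
  have h2 := DETC.log_div_le_two_mul_sqrt (T := T) (Nat.cast_nonneg T) hgap
  constructor
  · refine h1.trans (mul_le_mul_of_nonneg_right (by linarith) (by linarith))
  · nlinarith
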